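/- A configuration is a finite nonempty set of unit cells (modules) of the square grid, considered up to translation; it is facet-connected if the graph joining modules that share an edge is connected. A pivoting move rotates one module $a$ about one of its vertices, through empty space, while the remaining modules are facet-connected, so that the resulting configuration is facet-connected. In coordinates, up to rotation and reflection, let $a=(0,1)$ and let the rotation be clockwise about the common vertex of the cells $(0,0),(1,0),(0,1),(1,1)$. - The restrictive set of moves consists of: the $90^\circ$ rotation of $a$ to $(1,1)$, allowed if $(0,0),(1,0)$ are modules and $(1,1),(0,2),(1,2)$ are empty; and the $180^\circ$ rotation of $a$ to $(1,0)$, allowed if $(0,0)$ is a module and $(1,0),(1,1),(0,2),(1,2),(2,1),(2,0)$ are empty. - The leapfrog set of moves contains in addition the $90^\circ$ rotation of $a$ to $(1,1)$ whenever at least one of $(0,0),(1,0)$ is a module, $(1,1),(0,2),(1,2)$ are empty, and $a$ shares an edge with some other module both before and after the move. For a fixed one of these two sets of moves, the reconfiguration graph $\mathcal G_n$ has as nodes the facet-connected configurations of $n$ modules, two distinct ones being joined if one is obtained from the other by a single move. Up to rotation and reflection, a configuration contains pattern $\Gamma$ (corner bottleneck) if for some $(x,y)$ the cells $(x,y),(x+1,y+1)$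 are modules and the other two cells of this $2\times2$ box are empty; pattern I (corridor bottleneck) if $(x,y),(x+2,y)$ are modules and $(x+1,y)$ is empty; pattern Z (wide bottleneck) if $(x,y),(x+2,y+1)$ are modules and the other four cells of this $3\times 2$ box are empty. Say that it shows only pattern I if it contains pattern I and neither $\Gamma$ nor Z. **Proposition.** For each of the two sets of moves (restrictive and leapfrog): 1. there is a constant $c>1$ such that, for all sufficiently large $n$, at least $c^n$ connected components of $\mathcal G_n$ are singletons whose configuration shows only pattern I; 2. there are constants $c,d>1$ such that, for all sufficiently large $n$, at least $c^n$ connected components of $\mathcal G_n$ have at least $d^n$ nodes and consist entirely of configurations that show only pattern I. -/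

import Mathlib

namespace PivotingSquares

/-- A cell of the square grid, named by the integer coordinates of its centre. -/
abbrev Cell : Type := ℤ × ℤ

/-- Two cells are facet-adjacent if they share an edge. -/
def FacetAdj (p q : Cell) : Prop := |p.1 - q.1| + |p.2 - q.2| = 1

/-- The facet-adjacency graph of the whole square grid. -/
def gridGraph : SimpleGraph Cell where
  Adj := FacetAdj
  symm := ⟨fun p q h => by
    unfold FacetAdj at *
    rwa [abs_sub_comm q.1, abs_sub_comm q.2]⟩
  loopless := ⟨fun p h => by simp [FacetAdj] at h⟩

/-- A finite set of modules is facet-connected if its facet-adjacency graph is connected. -/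
def FacetConnected (C : Finset Cell) : Prop :=
  (gridGraph.induce (C : Set Cell)).Connected

/-- `u` and `v` are perpendicular unit grid directions. Quantifying over all such pairs runs
through the eight rotated and reflected copies of a local picture. -/
def Frame (u v : Cell) : Prop :=
  |u.1| + |u.2| = 1 ∧ |v.1| + |v.2| = 1 ∧ u.1 * v.1 + u.2 * v.2 = 0

/-! ### Pivoting moves

In all three moves the module at `a` rotates towards direction `u`, about its vertex that lies
in the directions `u` and `-v`. The cells around that vertex are `a`, `a - v`, `a + u - v` and
`a + u`. A rotation by 90 degrees ends in `a + u` and sweeps through parts of `a + v` and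
`a + u + v`; continuing for another 90 degrees ends in `a + u - v` and sweeps through parts of
`a + 2 • u` and `a + 2 • u - v`. -/

/-- The cells met by a rotation by 90 degrees are empty. -/
def QuarterTurnClear (C : Finset Cell) (a u v : Cell) : Prop :=
  a + u ∉ C ∧ a + v ∉ C ∧ a + u + v ∉ C

/-- The cells met by a rotation by 180 degrees are empty. -/
def HalfTurnClear (C : Finset Cell) (a u v : Cell) : Prop :=
  QuarterTurnClear C a u v ∧ a + u - v ∉ C ∧ a + 2 • u ∉ C ∧ a + 2 • u - v ∉ C

/-- The restrictive set of moves (Set 1): `a` is facet-adjacent to a module `s = a - v` and rotates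
about a vertex of their common edge, by 90 degrees if `s` has a neighbour `s' = a + u - v` across
its other edge at that vertex, and by 180 degrees if it has not. -/
def RestrictivePivot (C : Finset Cell) (a b : Cell) : Prop :=
  ∃ u v : Cell, Frame u v ∧ a - v ∈ C ∧
    ((a + u - v ∈ C ∧ QuarterTurnClear C a u v ∧ b = a + u) ∨
     (HalfTurnClear C a u v ∧ b = a + u - v))

/-- The additional moves of the leapfrog set: `a` rotates by 90 degrees about a vertex that it shares
with a module (`a - v` or `a + u - v`), and it is facet-adjacent to some other module both before
and after the move. -/
def LeapfrogQuarterTurn (C : Finset Cell) (a b : Cell) : Prop :=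
  (∃ u v : Cell, Frame u v ∧ (a - v ∈ C ∨ a + u - v ∈ C) ∧ QuarterTurnClear C a u v ∧ b = a + u) ∧
  (∃ s ∈ C.erase a, FacetAdj a s) ∧ (∃ t ∈ C.erase a, FacetAdj b t)

/-- The two sets of pivoting moves under consideration. -/
inductive MoveSet : Type
  /-- Set 1. -/
  | restrictive
  /-- Set 2. -/
  | leapfrog

/-- In the configuration `C` the set of moves `M` has a move that takes a module from `a` to `b`. -/
def CanPivot : MoveSet → Finset Cell → Cell → Cell → Prop
  | .restrictive, C, a, b => RestrictivePivot C a b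
  | .leapfrog, C, a, b => RestrictivePivot C a b ∨ LeapfrogQuarterTurn C a b

/-- `D` arises from `C` by one pivoting move of one module, while the other modules are
facet-connected. -/
def PivotMove (M : MoveSet) (C D : Finset Cell) : Prop :=
  ∃ a ∈ C, ∃ b, CanPivot M C a b ∧ FacetConnected (C.erase a) ∧ D = insert b (C.erase a)

/-! ### The reconfiguration graph -/

/-- A facet-connected configuration of `n` modules, placed in the grid. -/
def PlacedConfig (n : ℕ) : Type := {C : Finset Cell // C.card = n ∧ FacetConnected C}

/-- Two placed configurations are identified if they are translates of each other. -/
def translationSetoid (n : ℕ) : Setoid (PlacedConfig n) where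
  r C D := ∃ w : Cell, ∀ p, p ∈ C.1 ↔ p + w ∈ D.1
  iseqv :=
    { refl := fun _ => ⟨0, fun p => by simp⟩
      symm := fun ⟨w, h⟩ => ⟨-w, fun p => by simp [h]⟩
      trans := fun ⟨w, h⟩ ⟨w', h'⟩ => ⟨w + w', fun p => by rw [h, h', add_assoc]⟩ }

/-- A configuration of `n` modules, up to translation. -/
def Config (n : ℕ) : Type := Quotient (translationSetoid n)

/-- The configuration given by a placed configuration. -/
def PlacedConfig.toConfig {n : ℕ} (C : PlacedConfig n) : Config n :=
  Quotient.mk (translationSetoid n) C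

/-- The reconfiguration graph of `n` modules under the set of moves `M`. -/
def reconfigurationGraph (M : MoveSet) (n : ℕ) : SimpleGraph (Config n) :=
  SimpleGraph.fromRel fun X Y =>
    ∃ C D : PlacedConfig n, C.toConfig = X ∧ D.toConfig = Y ∧ PivotMove M C.1 D.1

/-! ### The three local patterns

Each one consists of two modules at the ends of an otherwise empty box of cells, of size
`2 × 2` (opposite corners), `1 × 3`, and `2 × 3` (opposite corners), respectively. -/

/-- Corner bottleneck. -/
def HasPatternGamma (C : Finset Cell) : Prop :=
  ∃ p u v : Cell, Frame u v ∧ p ∈ C ∧ p + u + v ∈ C ∧ p + u ∉ C ∧ p + v ∉ C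

/-- Corridor bottleneck. -/
def HasPatternI (C : Finset Cell) : Prop :=
  ∃ p u v : Cell, Frame u v ∧ p ∈ C ∧ p + 2 • u ∈ C ∧ p + u ∉ C

/-- Wide bottleneck. -/
def HasPatternZ (C : Finset Cell) : Prop :=
  ∃ p u v : Cell, Frame u v ∧ p ∈ C ∧ p + 2 • u + v ∈ C ∧
    p + u ∉ C ∧ p + 2 • u ∉ C ∧ p + v ∉ C ∧ p + u + v ∉ C

/-- The configuration shows only the corridor-bottleneck pattern. -/
def OnlyPatternI {n : ℕ} (X : Config n) : Prop :=
  ∀ C : PlacedConfig n, C.toConfig = X →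
    HasPatternI C.1 ∧ ¬ HasPatternGamma C.1 ∧ ¬ HasPatternZ C.1

/-- The components of the full reconfiguration graph all of whose configurations show only the
corridor-bottleneck pattern. -/
def patternIComponents (M : MoveSet) (n : ℕ) :
    Set (reconfigurationGraph M n).ConnectedComponent :=
  {K | ∀ X ∈ K.supp, OnlyPatternI X}

end PivotingSquares

namespace PivotingSquares

/-! ### Facet-connectedness by ranks -/

/-! The witnesses are trees of modules. One long path starts in the first tile, runs right along row
0, turns back in the last tile, returns along row 5 and ends in the first tile; short towers and
single sliding modules branch off it. A module that is not a leaf of the tree is a cut vertex, so it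
cannot move. The leaves are the two ends of the path, the tops of the towers and the sliders.

Each end and each top stands beside corridors of width one. A rotation by 180 degrees into such a
corridor is stopped by the module on its far side, which is exactly pattern I. A restrictive
rotation by 90 degrees lacks the second supporting module, and a leapfrog one would land without any
neighbour. A slider walks freely along its plateau of three cells and is stopped in the same way at
the dips on both sides. Hence the component of such a configuration consists of all configurations
with the same word of tiles up to slider states (`PivotMove.exists_eq_assemble`,
`SameSkeleton.joined`, `mem_supp_iff`). Bumps on the upper or the lower path give `2 ^ a` different
components (`eq_of_isTranslate`, `two_pow_le_ncard`), and `m` sliders give `3 ^ m` nodes in each.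
Tiles of 27, 28 and 29 modules make every large `n` attainable.

The geometry is a finite check per tile. At a seam all tiles consist of the same two straight rows,
so a picture with two extra columns on each side decides everything within reach of a move or a
pattern (`LooksLike`). The tree is encoded by `rankOf`: every module except the root has exactly one
neighbour of lower rank and none of equal rank, a local condition that yields both connectedness and
the cut vertices. -/

theorem FacetAdj.symm {p q : Cell} (h : FacetAdj p q) : FacetAdj q p :=
  gridGraph.adj_symm h

/-- A nonempty set of cells is facet-connected iff a set that contains one of its cells, and with
each of its cells also the facet-adjacent ones, contains all of them. -/
theorem facetConnected_iff {C : Finset Cell} :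
    FacetConnected C ↔ C.Nonempty ∧ ∀ S : Set Cell,
      (∀ p ∈ C, ∀ q ∈ C, FacetAdj p q → p ∈ S → q ∈ S) → (∃ p ∈ C, p ∈ S) → ∀ q ∈ C, q ∈ S := by
  constructor
  · intro h
    refine ⟨?_, ?_⟩
    · obtain ⟨⟨x, hx⟩⟩ := h.nonempty
      exact ⟨x, hx⟩
    · rintro S hS ⟨p, hp, hpS⟩ q hq
      obtain ⟨W⟩ := h.preconnected ⟨p, hp⟩ ⟨q, hq⟩
      have key : ∀ (x y : (C : Set Cell)), (gridGraph.induce (C : Set Cell)).Walk x y →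
          x.1 ∈ S → y.1 ∈ S := by
        intro x y W
        induction W with
        | nil => exact id
        | cons h _ ih => exact fun hx => ih (hS _ (Subtype.prop _) _ (Subtype.prop _) h hx)
      exact key _ _ W hpS
  · rintro ⟨⟨o, ho⟩, h⟩
    have key : ∀ q (hq : q ∈ C), (gridGraph.induce (C : Set Cell)).Reachable ⟨o, ho⟩ ⟨q, hq⟩ := by
      intro q hq
      obtain ⟨_, h'⟩ := h {q | ∃ hq : q ∈ C,
        (gridGraph.induce (C : Set Cell)).Reachable ⟨o, ho⟩ ⟨q, hq⟩}
        (by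
          rintro p hp q hq hpq ⟨_, h1⟩
          refine ⟨hq, h1.trans (SimpleGraph.Adj.reachable ?_)⟩
          exact hpq) ⟨o, ho, ho, SimpleGraph.Reachable.refl _⟩ q hq
      exact h'
    have : Nonempty (C : Set Cell) := ⟨⟨o, ho⟩⟩
    exact ⟨fun x y => (key x.1 x.2).symm.trans (key y.1 y.2)⟩

variable {α : Type*} [LinearOrder α]

/-- If every cell other than `o` has a neighbour of lower rank, then the set is facet-connected. -/
theorem facetConnected_of_rank (r : Cell → α) {C : Finset Cell} {o : Cell} (ho : o ∈ C)
    (h : ∀ p ∈ C, p ≠ o → ∃ q ∈ C, FacetAdj p q ∧ r q < r p) : FacetConnected C := by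
  classical
  rw [facetConnected_iff]
  refine ⟨⟨o, ho⟩, ?_⟩
  rintro S hS ⟨p, hp, hpS⟩ q hq
  have key : ∀ T : Set Cell, (∀ p ∈ C, ∀ q ∈ C, FacetAdj p q → p ∈ T → q ∈ T) → o ∈ T →
      ∀ q ∈ C, q ∈ T := by
    intro T hT hoT
    by_contra! hcon
    obtain ⟨x, hx, hmin⟩ := (C.filter (· ∉ T)).exists_min_image r
      (by obtain ⟨q, hq, hqT⟩ := hcon; exact ⟨q, by simp [hq, hqT]⟩)
    rw [Finset.mem_filter] at hx
    obtain ⟨y, hy, hxy, hlt⟩ := h x hx.1 (by rintro rfl; exact hx.2 hoT)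
    by_cases hyT : y ∈ T
    · exact hx.2 (hT y hy x hx.1 hxy.symm hyT)
    · exact absurd (hmin y (by simp [hy, hyT])) (not_le.2 hlt)
  -- Adjacency is symmetric, so the complement of a closed set is closed. If `o` is not in `S`, the
  -- complement would therefore be everything.
  by_cases hoS : o ∈ S
  · exact key S hS hoS q hq
  · exact absurd hpS (key Sᶜ (fun p hp q hq hpq hpS hqS => hpS (hS q hq p hp hpq.symm hqS)) hoS p hp)

/-- If no cell has two neighbours of lower rank, then a cell with both a lower and a higher
neighbour is a cut vertex. -/
theorem not_facetConnected_erase (r : Cell → α) {C : Finset Cell}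
    (hne : ∀ p ∈ C, ∀ q ∈ C, FacetAdj p q → r p ≠ r q)
    (huniq : ∀ p ∈ C, ∀ q ∈ C, ∀ q' ∈ C, FacetAdj p q → FacetAdj p q' → r q < r p → r q' < r p →
      q = q')
    {a l h : Cell} (ha : a ∈ C) (hl : l ∈ C) (hh : h ∈ C) (hal : FacetAdj a l)
    (hah : FacetAdj a h) (hla : r l < r a) (hha : r a < r h) :
    ¬ FacetConnected (C.erase a) := by
  intro hcon
  rw [facetConnected_iff] at hcon
  let R : Cell → Cell → Prop := fun p q => p ∈ C ∧ q ∈ C ∧ FacetAdj p q ∧ r q < r p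
  have hle : ∀ p, Relation.ReflTransGen R p h → r h ≤ r p := by
    intro p hp
    induction hp using Relation.ReflTransGen.head_induction_on with
    | refl => exact le_rfl
    | head h1 _ ih => exact ih.trans h1.2.2.2.le
  -- The cells from which a descending chain leads to `h` form a set that is closed in `C.erase a`:
  -- a downward edge must follow the unique chain, and the only one that leaves the set goes from
  -- `h` to the erased `a`. The cell `l` is too low to belong to it.
  have hmem := hcon.2 {p | Relation.ReflTransGen R p h} ?_ ⟨h, ?_, Relation.ReflTransGen.refl⟩ l ?_
  · exact absurd (hle l hmem) (not_le.2 (hla.trans hha))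
  · intro p hp q hq hpq hpS
    rw [Finset.mem_erase] at hp hq
    rcases lt_or_gt_of_ne (hne p hp.2 q hq.2 hpq) with hlt | hlt
    · exact Relation.ReflTransGen.head ⟨hq.2, hp.2, hpq.symm, hlt⟩ hpS
    · rcases Relation.ReflTransGen.cases_head hpS with rfl | ⟨p', hpp', hp'⟩
      · exact absurd (huniq _ hp.2 _ hq.2 _ ha hpq hah.symm hlt hha) hq.1
      · rwa [Set.mem_ofPred_eq, huniq _ hp.2 _ hq.2 _ hpp'.2.1 hpq hpp'.2.2.1 hlt hpp'.2.2.2]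
  · rw [Finset.mem_erase]
    exact ⟨by rintro rfl; exact lt_irrefl _ hha, hh⟩
  · rw [Finset.mem_erase]
    exact ⟨by rintro rfl; exact lt_irrefl _ hla, hl⟩

/-! ### Directions and frames -/

/-- The four unit grid directions. -/
def dirs : List Cell := [(1, 0), (-1, 0), (0, 1), (0, -1)]

/-- The eight pairs of perpendicular unit grid directions. -/
def frames : List (Cell × Cell) :=
  [((1, 0), (0, 1)), ((1, 0), (0, -1)), ((-1, 0), (0, 1)), ((-1, 0), (0, -1)),
   ((0, 1), (1, 0)), ((0, 1), (-1, 0)), ((0, -1), (1, 0)), ((0, -1), (-1, 0))]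

theorem mem_dirs {u : Cell} : u ∈ dirs ↔ |u.1| + |u.2| = 1 := by
  obtain ⟨x, y⟩ := u
  simp only [dirs, List.mem_cons, Prod.mk.injEq, List.not_mem_nil, or_false]
  constructor
  · rintro (⟨rfl, rfl⟩ | ⟨rfl, rfl⟩ | ⟨rfl, rfl⟩ | ⟨rfl, rfl⟩) <;> rfl
  · intro h
    rcases abs_cases x with ⟨h1, _⟩ | ⟨h1, _⟩ <;> rcases abs_cases y with ⟨h2, _⟩ | ⟨h2, _⟩ <;> omega

theorem frame_iff {u v : Cell} : Frame u v ↔ (u, v) ∈ frames := by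
  constructor
  · rintro ⟨hu, hv, h⟩
    rw [← mem_dirs] at hu hv
    simp only [dirs, List.mem_cons, List.not_mem_nil, or_false] at hu hv
    rcases hu with rfl | rfl | rfl | rfl <;> rcases hv with rfl | rfl | rfl | rfl <;>
      simp [frames] at h ⊢
  · intro h
    simp only [frames, List.mem_cons, Prod.mk.injEq, List.not_mem_nil, or_false] at h
    rcases h with ⟨rfl, rfl⟩ | ⟨rfl, rfl⟩ | ⟨rfl, rfl⟩ | ⟨rfl, rfl⟩ | ⟨rfl, rfl⟩ | ⟨rfl, rfl⟩ |
      ⟨rfl, rfl⟩ | ⟨rfl, rfl⟩ <;> exact ⟨rfl, rfl, rfl⟩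

theorem facetAdj_iff {p q : Cell} : FacetAdj p q ↔ ∃ d ∈ dirs, q = p + d := by
  constructor
  · intro h
    refine ⟨q - p, mem_dirs.2 ?_, by simp⟩
    have := h.symm
    simpa [FacetAdj] using this
  · rintro ⟨d, hd, rfl⟩
    have := mem_dirs.1 hd
    simp only [FacetAdj, Prod.fst_add, Prod.snd_add]
    rw [abs_sub_comm, abs_sub_comm p.2]
    simpa using this

theorem facetAdj_add {p d : Cell} (hd : d ∈ dirs) : FacetAdj p (p + d) :=
  facetAdj_iff.2 ⟨d, hd, rfl⟩

/-! ### Moves can be reversed -/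

theorem Frame.neg_left {u v : Cell} (h : Frame u v) : Frame (-u) v := by
  obtain ⟨h1, h2, h3⟩ := h
  refine ⟨by simpa using h1, h2, ?_⟩
  simp only [Prod.fst_neg, Prod.snd_neg]
  linarith

theorem Frame.swap {u v : Cell} (h : Frame u v) : Frame v u := by
  obtain ⟨h1, h2, h3⟩ := h
  exact ⟨h2, h1, by linarith⟩

theorem Frame.ne_zero {u v : Cell} (h : Frame u v) : u ≠ 0 ∧ v ≠ 0 ∧ u ≠ v ∧ u + v ≠ 0 := by
  rw [frame_iff] at h
  simp only [frames, List.mem_cons, Prod.mk.injEq, List.not_mem_nil, or_false] at h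
  rcases h with ⟨rfl, rfl⟩ | ⟨rfl, rfl⟩ | ⟨rfl, rfl⟩ | ⟨rfl, rfl⟩ | ⟨rfl, rfl⟩ | ⟨rfl, rfl⟩ |
    ⟨rfl, rfl⟩ | ⟨rfl, rfl⟩ <;> decide

theorem QuarterTurnClear.reverse {C : Finset Cell} {a u v : Cell} (hf : Frame u v)
    (h : QuarterTurnClear C a u v) :
    QuarterTurnClear (insert (a + u) (C.erase a)) (a + u) (-u) v := by
  obtain ⟨hu, hv, huv, huv'⟩ := hf.ne_zero
  obtain ⟨h1, h2, h3⟩ := h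
  refine ⟨?_, ?_, ?_⟩
  · simp [hu]
  · simp [hv, h3]
  · have e : a + u + -u + v = a + v := by abel
    rw [e]
    simp [hv, h2, huv.symm]

theorem RestrictivePivot.target_notMem {C : Finset Cell} {a b : Cell} (h : RestrictivePivot C a b) :
    b ∉ C := by
  obtain ⟨u, v, -, -, ⟨-, h, rfl⟩ | ⟨h, rfl⟩⟩ := h
  exacts [h.1, h.2.1]

theorem CanPivot.target_notMem {M : MoveSet} {C : Finset Cell} {a b : Cell} (h : CanPivot M C a b) :
    b ∉ C := by
  cases M
  · exact RestrictivePivot.target_notMem h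
  · rcases h with h | ⟨⟨u, v, -, -, h, rfl⟩, -⟩
    exacts [h.target_notMem, h.1]

theorem RestrictivePivot.reverse {C : Finset Cell} {a b : Cell} (h : RestrictivePivot C a b) :
    RestrictivePivot (insert b (C.erase a)) b a := by
  obtain ⟨u, v, hf, hs, ⟨hs', hq, rfl⟩ | ⟨hh, rfl⟩⟩ := h
  · obtain ⟨hu, hv, huv, huv'⟩ := hf.ne_zero
    refine ⟨-u, v, hf.neg_left, ?_, Or.inl ⟨?_, hq.reverse hf, by abel⟩⟩
    · refine Finset.mem_insert_of_mem (Finset.mem_erase.2 ⟨?_, hs'⟩)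
      rw [add_sub_assoc, Ne, add_eq_left, sub_eq_zero]
      exact huv
    · have e : a + u + -u - v = a - v := by abel
      rw [e]
      refine Finset.mem_insert_of_mem (Finset.mem_erase.2 ⟨?_, hs⟩)
      simpa using hv
  · obtain ⟨hu, hv, huv, huv'⟩ := hf.ne_zero
    obtain ⟨⟨h1, h2, h3⟩, h4, h5, h6⟩ := hh
    have hmem : ∀ p, p ∉ C → p ≠ a + u - v → p ∉ insert (a + u - v) (C.erase a) := by
      intro p hp hne
      simp [hp, hne]
    have hne : ∀ d : Cell, d ≠ 0 → ∀ q, q = a + u - v + d → q ≠ a + u - v := by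
      rintro d hd q rfl
      simpa using hd
    -- Seen from its other end, a half turn about the same vertex has the two directions of the
    -- frame exchanged.
    refine ⟨v, u, hf.swap, ?_, Or.inr ⟨⟨⟨?_, ?_, ?_⟩, ?_, ?_, ?_⟩, by abel⟩⟩
    · have e : a + u - v - u = a - v := by abel
      rw [e]
      refine Finset.mem_insert_of_mem (Finset.mem_erase.2 ⟨?_, hs⟩)
      simpa using hv
    · exact hmem _ (by rwa [show a + u - v + v = a + u by abel]) (hne v hv _ rfl)
    · exact hmem _ (by rwa [show a + u - v + u = a + 2 • u - v by abel]) (hne u hu _ rfl)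
    · exact hmem _ (by rwa [show a + u - v + v + u = a + 2 • u by abel])
        (hne (u + v) huv' _ (by abel))
    · have e : a + u - v + v - u = a := by abel
      rw [e]
      simp only [Finset.mem_insert, Finset.mem_erase, ne_eq, not_true_eq_false, false_and, or_false]
      exact hne (v - u) (sub_ne_zero.2 huv.symm) _ (by abel)
    · exact hmem _ (by rwa [show a + u - v + 2 • v = a + u + v by abel])
        (hne (2 • v) (smul_ne_zero two_ne_zero hv) _ rfl)
    · have e : a + u - v + 2 • v - u = a + v := by abel
      refine hmem _ (by rwa [e]) ?_
      rw [e]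
      intro h
      have h' : u = v + v := by
        have : a + v + (v - a) = a + u - v + (v - a) := by rw [h]
        calc u = a + u - v + (v - a) := by abel
          _ = v + v := by rw [← this]; abel
      have := hf.2.2
      rw [h'] at this
      simp only [Prod.fst_add, Prod.snd_add] at this
      have h1 : v.1 * v.1 + v.2 * v.2 = 0 := by linarith
      apply hv
      ext
      · simp only [Prod.fst_zero]; nlinarith
      · simp only [Prod.snd_zero]; nlinarith

theorem LeapfrogQuarterTurn.reverse {C : Finset Cell} {a b : Cell}
    (h : LeapfrogQuarterTurn C a b) : LeapfrogQuarterTurn (insert b (C.erase a)) b a := by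
  obtain ⟨⟨u, v, hf, hs, hq, rfl⟩, h1, h2⟩ := h
  obtain ⟨hu, hv, huv, huv'⟩ := hf.ne_zero
  have e : (insert (a + u) (C.erase a)).erase (a + u) = C.erase a :=
    Finset.erase_insert (fun h => hq.1 (Finset.mem_of_mem_erase h))
  refine ⟨⟨-u, v, hf.neg_left, ?_, hq.reverse hf, by abel⟩, ?_, ?_⟩
  · rw [show a + u + -u - v = a - v by abel]
    refine hs.symm.imp (fun hs => ?_) fun hs => ?_ <;>
      refine Finset.mem_insert_of_mem (Finset.mem_erase.2 ⟨?_, hs⟩)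
    · rw [add_sub_assoc, Ne, add_eq_left, sub_eq_zero]
      exact huv
    · simpa using hv
  · rwa [e]
  · rwa [e]

/-- `SimpleGraph.fromRel` also joins a node to those that move into it. Reversibility turns these
moves into moves out of the node, so classifying outgoing moves is enough. -/
theorem PivotMove.symm {M : MoveSet} {C D : Finset Cell} (h : PivotMove M C D) :
    PivotMove M D C := by
  obtain ⟨a, ha, b, hp, hc, rfl⟩ := h
  have hb := hp.target_notMem
  have e : (insert b (C.erase a)).erase b = C.erase a :=
    Finset.erase_insert (fun h => hb (Finset.mem_of_mem_erase h))
  refine ⟨b, Finset.mem_insert_self _ _, a, ?_, by rwa [e], by rw [e, Finset.insert_erase ha]⟩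
  cases M
  · exact RestrictivePivot.reverse hp
  · exact hp.imp RestrictivePivot.reverse LeapfrogQuarterTurn.reverse

/-! ### Translations -/

theorem FacetAdj.add_right {p q : Cell} (h : FacetAdj p q) (t : Cell) :
    FacetAdj (p + t) (q + t) := by
  simpa [FacetAdj] using h

/-- `D` is the translate of `C` by `t`. -/
def IsTranslate (t : Cell) (C D : Finset Cell) : Prop := ∀ p, p ∈ C ↔ p + t ∈ D

namespace IsTranslate

variable {t : Cell} {C D : Finset Cell}

theorem symm (h : IsTranslate t C D) : IsTranslate (-t) D C := fun p => by simp [h (p + -t)]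

theorem erase (h : IsTranslate t C D) (a : Cell) : IsTranslate t (C.erase a) (D.erase (a + t)) :=
  fun p => by simp [h p]

theorem insert (h : IsTranslate t C D) (a : Cell) :
    IsTranslate t (insert a C) (insert (a + t) D) := fun p => by simp [h p]

theorem facetConnected (h : IsTranslate t C D) (hC : FacetConnected C) : FacetConnected D := by
  rw [facetConnected_iff] at hC ⊢
  refine ⟨?_, ?_⟩
  · obtain ⟨p, hp⟩ := hC.1
    exact ⟨p + t, (h p).1 hp⟩
  · rintro S hS ⟨p, hp, hpS⟩ q hq
    have := hC.2 {p | p + t ∈ S}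
      (fun p hp q hq hpq hpS => hS _ ((h p).1 hp) _ ((h q).1 hq) (hpq.add_right t) hpS)
      ⟨p - t, (h _).2 (by simpa using hp), by simpa using hpS⟩ (q - t)
      ((h _).2 (by simpa using hq))
    simpa using this

theorem quarterTurnClear (h : IsTranslate t C D) {a u v : Cell} (hC : QuarterTurnClear C a u v) :
    QuarterTurnClear D (a + t) u v := by
  obtain ⟨h1, h2, h3⟩ := hC
  rw [h] at h1 h2 h3
  refine ⟨?_, ?_, ?_⟩
  · rwa [show a + t + u = a + u + t by abel]
  · rwa [show a + t + v = a + v + t by abel]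
  · rwa [show a + t + u + v = a + u + v + t by abel]

theorem restrictivePivot (h : IsTranslate t C D) {a b : Cell} (hC : RestrictivePivot C a b) :
    RestrictivePivot D (a + t) (b + t) := by
  obtain ⟨u, v, hf, hs, hC⟩ := hC
  refine ⟨u, v, hf, ?_, hC.imp ?_ ?_⟩
  · rwa [show a + t - v = a - v + t by abel, ← h]
  · rintro ⟨hs', hq, rfl⟩
    exact ⟨by rwa [show a + t + u - v = a + u - v + t by abel, ← h], h.quarterTurnClear hq, by abel⟩
  · rintro ⟨⟨hq, h1, h2, h3⟩, rfl⟩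
    refine ⟨⟨h.quarterTurnClear hq, ?_, ?_, ?_⟩, by abel⟩
    · rwa [show a + t + u - v = a + u - v + t by abel, ← h]
    · rwa [show a + t + 2 • u = a + 2 • u + t by abel, ← h]
    · rwa [show a + t + 2 • u - v = a + 2 • u - v + t by abel, ← h]

theorem leapfrogQuarterTurn (h : IsTranslate t C D) {a b : Cell}
    (hC : LeapfrogQuarterTurn C a b) : LeapfrogQuarterTurn D (a + t) (b + t) := by
  obtain ⟨⟨u, v, hf, hs, hq, rfl⟩, ⟨s, hs1, hs2⟩, ⟨s', hs1', hs2'⟩⟩ := hC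
  refine ⟨⟨u, v, hf, hs.imp ?_ ?_, h.quarterTurnClear hq, by abel⟩,
    ⟨s + t, (h.erase a s).1 hs1, hs2.add_right t⟩, ⟨s' + t, (h.erase a s').1 hs1', hs2'.add_right t⟩⟩
  · intro hs
    rwa [show a + t - v = a - v + t by abel, ← h]
  · intro hs
    rwa [show a + t + u - v = a + u - v + t by abel, ← h]

/-- Nodes are translation classes. This allows every move out of a class to be studied at one fixed
placement. -/
theorem pivotMove (h : IsTranslate t C D) {M : MoveSet} {C' : Finset Cell}
    (hC : PivotMove M C C') : ∃ D', PivotMove M D D' ∧ IsTranslate t C' D' := by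
  obtain ⟨a, ha, b, hp, hc, rfl⟩ := hC
  refine ⟨_, ⟨a + t, (h a).1 ha, b + t, ?_, (h.erase a).facetConnected hc, rfl⟩,
    (h.erase a).insert b⟩
  cases M
  · exact h.restrictivePivot hp
  · exact hp.imp h.restrictivePivot h.leapfrogQuarterTurn

theorem hasPatternGamma (h : IsTranslate t C D) (hC : HasPatternGamma C) : HasPatternGamma D := by
  obtain ⟨p, u, v, hf, h1, h2, h3, h4⟩ := hC
  rw [h] at h1 h2 h3 h4
  exact ⟨p + t, u, v, hf, h1, by convert h2 using 1; abel, by convert h3 using 2; abel,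
    by convert h4 using 2; abel⟩

theorem hasPatternI (h : IsTranslate t C D) (hC : HasPatternI C) : HasPatternI D := by
  obtain ⟨p, u, v, hf, h1, h2, h3⟩ := hC
  rw [h] at h1 h2 h3
  exact ⟨p + t, u, v, hf, h1, by convert h2 using 1; abel, by convert h3 using 2; abel⟩

theorem hasPatternZ (h : IsTranslate t C D) (hC : HasPatternZ C) : HasPatternZ D := by
  obtain ⟨p, u, v, hf, h1, h2, h3, h4, h5, h6⟩ := hC
  rw [h] at h1 h2 h3 h4 h5 h6
  exact ⟨p + t, u, v, hf, h1, by convert h2 using 1; abel, by convert h3 using 2; abel,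
    by convert h4 using 2; abel, by convert h5 using 2; abel, by convert h6 using 2; abel⟩

end IsTranslate

theorem PlacedConfig.toConfig_eq_iff {n : ℕ} {C D : PlacedConfig n} :
    C.toConfig = D.toConfig ↔ ∃ t, IsTranslate t C.1 D.1 :=
  Quotient.eq (r := translationSetoid n)

/-! ### There are finitely many configurations -/

/-- Discrete intermediate value theorem: `φ` rises by at most one along an edge, so it cannot jump
over `x`. -/
theorem exists_eq_of_facetConnected {C : Finset Cell} (hC : FacetConnected C) {φ : Cell → ℤ}
    (hφ : ∀ p q, FacetAdj p q → φ q ≤ φ p + 1) {a b : Cell} (ha : a ∈ C) (hb : b ∈ C) {x : ℤ}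
    (h1 : φ a ≤ x) (h2 : x ≤ φ b) : ∃ c ∈ C, φ c = x := by
  by_contra! hcon
  have := (facetConnected_iff.1 hC).2 {p | φ p < x} ?_
    ⟨a, ha, lt_of_le_of_ne h1 (hcon a ha)⟩ b hb
  · exact absurd this (not_lt.2 h2)
  · intro p hp q hq hpq hpS
    have hlt : φ p < x := hpS
    have := hφ p q hpq
    exact lt_of_le_of_ne (by omega) (hcon q hq)

theorem sub_lt_card_of_facetConnected {C : Finset Cell} (hC : FacetConnected C) {φ : Cell → ℤ}
    (hφ : ∀ p q, FacetAdj p q → φ q ≤ φ p + 1) {a b : Cell} (ha : a ∈ C) (hb : b ∈ C) :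
    φ b - φ a < C.card := by
  classical
  have hsub : Finset.Icc (φ a) (φ b) ⊆ C.image φ := by
    intro x hx
    rw [Finset.mem_Icc] at hx
    obtain ⟨c, hc, rfl⟩ := exists_eq_of_facetConnected hC hφ ha hb hx.1 hx.2
    exact Finset.mem_image_of_mem _ hc
  have := (Finset.card_le_card hsub).trans Finset.card_image_le
  rw [Int.card_Icc] at this
  omega

theorem FacetAdj.le {p q : Cell} (h : FacetAdj p q) : |p.1 - q.1| ≤ 1 ∧ |p.2 - q.2| ≤ 1 := by
  have h : |p.1 - q.1| + |p.2 - q.2| = 1 := h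
  constructor <;> linarith [abs_nonneg (p.1 - q.1), abs_nonneg (p.2 - q.2)]

/-- `Set.ncard` vanishes on infinite sets, so the lower bounds need finiteness. With one module
moved to the origin, all coordinates are smaller than `n` in absolute value. -/
instance instFiniteConfig (n : ℕ) : Finite (Config n) := by
  classical
  have hfin : {C : PlacedConfig n | C.1 ⊆ Finset.Icc ((-n, -n) : Cell) (n, n)}.Finite := by
    refine Set.Finite.of_finite_image (f := Subtype.val)
      ((Finset.finite_toSet (Finset.Icc ((-n, -n) : Cell) (n, n)).powerset).subset ?_)
      Subtype.val_injective.injOn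
    rintro _ ⟨C, hC, rfl⟩
    exact Finset.mem_coe.2 (Finset.mem_powerset.2 hC)
  refine Set.finite_univ_iff.1 ((hfin.image PlacedConfig.toConfig).subset ?_)
  rintro X -
  obtain ⟨C, rfl⟩ := Quotient.exists_rep X
  obtain ⟨o, ho⟩ := (facetConnected_iff.1 C.2.2).1
  have hT : IsTranslate (-o) C.1 (C.1.map (addRightEmbedding (-o))) := fun p => by simp
  refine ⟨⟨C.1.map (addRightEmbedding (-o)), ?_, hT.facetConnected C.2.2⟩, ?_, ?_⟩
  · rw [Finset.card_map, C.2.1]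
  · intro p hp
    have hp' : p + o ∈ C.1 := by
      obtain ⟨q, hq, rfl⟩ := Finset.mem_map.1 hp
      simpa using hq
    have key := fun (φ : Cell → ℤ) hφ => sub_lt_card_of_facetConnected (φ := φ) C.2.2 hφ ho hp'
    rw [C.2.1] at key
    have h1 := key (fun p => p.1) fun p q h => by have := abs_le.1 h.le.1; omega
    have h2 := key (fun p => -p.1) fun p q h => by have := abs_le.1 h.le.1; omega
    have h3 := key (fun p => p.2) fun p q h => by have := abs_le.1 h.le.2; omega
    have h4 := key (fun p => -p.2) fun p q h => by have := abs_le.1 h.le.2; omega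
    simp only [Prod.fst_add, Prod.snd_add] at h1 h2 h3 h4
    simp only [Finset.mem_Icc, Prod.le_def]
    omega
  · exact PlacedConfig.toConfig_eq_iff.2 ⟨_, hT.symm⟩

/-! ### Tiles

A configuration is assembled from tiles that are eleven columns wide. The picture of a tile also
shows two columns of each adjacent tile. -/

/-- The tiles between the first and the last one. -/
inductive Mid : Type
  /-- A dip of the upper path that holds a tower of three modules. -/
  | pad
  /-- A bump of the upper path (`true`) or of the lower path (`false`). -/
  | bit (b : Bool)
  /-- A plateau of the upper path with a module that can slide along it. -/
  | mob (s : Fin 3)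
  deriving DecidableEq

/-- The tiles. -/
inductive Tile : Type
  /-- The first tile, which holds both ends of the path. -/
  | head
  /-- A tile between the first and the last one. -/
  | mid (m : Mid)
  /-- The last tile. -/
  | tail
  deriving DecidableEq

/-- The picture of a tile as a list of rectangles, each given by its range of columns and its range
of rows. -/
def Tile.rects : Tile → List ((ℤ × ℤ) × (ℤ × ℤ))
  -- The ends of the path, `(6, 1)` and `(4, -2)`, are hooks symmetric about a point. Columns 3, 5
  -- and 7 are the corridors that keep them from turning.
  | head => [((0, 0), (-1, 5)), ((0, 12), (5, 5)), ((0, 2), (-1, -1)), ((2, 2), (-1, 0)),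
      ((2, 4), (0, 0)), ((4, 4), (-2, 0)), ((6, 6), (-1, 1)), ((6, 8), (-1, -1)),
      ((8, 8), (-1, 0)), ((8, 12), (0, 0))]
  | tail => [((-2, 2), (0, 0)), ((2, 2), (0, 5)), ((-2, 2), (5, 5))]
  -- The top `(5, 6)` of the tower exceeds the rims at columns 3 and 7 by one row, so that these
  -- rims block its half turns.
  | mid .pad => [((-2, 12), (0, 0)), ((-2, 3), (5, 5)), ((3, 3), (3, 5)), ((3, 7), (3, 3)),
      ((5, 5), (3, 6)), ((7, 7), (3, 5)), ((7, 12), (5, 5))]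
  | mid (.bit true) => [((-2, 12), (0, 0)), ((-2, 4), (5, 5)), ((4, 4), (5, 8)), ((4, 6), (8, 8)),
      ((6, 6), (5, 8)), ((6, 12), (5, 5))]
  | mid (.bit false) => [((-2, 12), (5, 5)), ((-2, 4), (0, 0)), ((4, 4), (-3, 0)),
      ((4, 6), (-3, -3)), ((6, 6), (-3, 0)), ((6, 12), (0, 0))]
  | mid (.mob s) => [((-2, 12), (0, 0)), ((-2, 2), (5, 5)), ((2, 2), (4, 5)), ((2, 4), (4, 4)),
      ((4, 4), (4, 5)), ((4, 6), (5, 5)), ((6, 6), (4, 5)), ((6, 8), (4, 4)), ((8, 8), (4, 5)),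
      ((8, 12), (5, 5)), ((4 + s.val, 4 + s.val), (6, 6))]

/-- The picture of the tile has a module at `q`. -/
def Tile.has (τ : Tile) (q : Cell) : Bool :=
  τ.rects.any fun R => decide (R.1.1 ≤ q.1) && decide (q.1 ≤ R.1.2) &&
    (decide (R.2.1 ≤ q.2) && decide (q.2 ≤ R.2.2))

/-- The place of the sliding module. -/
def leaf (s : Fin 3) : Cell := (4 + s.val, 6)

/-- The part of the path to which a cell belongs: the path runs to the right in the parts `0` and
`2` and to the left in part `1`. -/
def Tile.part (τ : Tile) (q : Cell) : ℤ :=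
  if τ = head ∧ (q.1 = 0 ∨ (q.1 ≤ 4 ∧ q.2 ≤ 0)) then 2
  else if τ = tail ∧ q.1 = 2 then 0
  else if 2 ≤ q.2 then 1 else 0

/-- The order of the cells of a path within a column. -/
def Tile.height (τ : Tile) (q : Cell) : ℤ :=
  match τ with
  | head => if q.1 = 0 ∨ q.1 = 4 ∨ q.1 = 6 then -q.2 else q.2
  | tail => q.2
  | mid .pad => if q.1 = 7 then -q.2 else q.2
  | mid (.bit _) => if q.1 = 4 then -q.2 else q.2
  -- In column 4 the path arrives at row 5 and goes down, while the slider may sit above. Both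
  -- neighbours must be higher than row 5, whence the absolute value.
  | mid (.mob _) => if q.1 = 8 then -q.2 else if q.1 = 4 then |q.2 - 5| else q.2

/-- The rank of a module in column `x`, if it has the place `q` in the picture of its tile. -/
def Tile.rank (τ : Tile) (x : ℤ) (q : Cell) : ℤ ×ₗ ℤ :=
  -- Heights of modules lie between -8 and 8, so with the weight 32 the column takes precedence
  -- within a part.
  toLex (τ.part q, (if τ.part q = 1 then -32 * x else 32 * x) + τ.height q)

/-- The place `q` has a lower rank than `q'`, both in the picture of the tile. -/
def Tile.below (τ : Tile) (q q' : Cell) : Bool :=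
  decide (τ.part q < τ.part q') || (decide (τ.part q = τ.part q') &&
    decide ((if τ.part q = 1 then -32 * q.1 else 32 * q.1) + τ.height q <
      (if τ.part q = 1 then -32 * q'.1 else 32 * q'.1) + τ.height q'))

/-- The cells of a tile proper. -/
def Tile.area : List Cell :=
  [0, 1, 2, 3, 4, 5, 6, 7, 8, 9, 10].flatMap fun x =>
    [-3, -2, -1, 0, 1, 2, 3, 4, 5, 6, 7, 8].map fun y => (x, y)

/-- All tiles. -/
def Tile.all : List Tile :=
  [head, tail, mid .pad, mid (.bit true), mid (.bit false), mid (.mob 0), mid (.mob 1),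
    mid (.mob 2)]

/-- The modules of a tile. -/
def Tile.cells (τ : Tile) : List Cell := Tile.area.filter τ.has

theorem Tile.mem_all (τ : Tile) : τ ∈ Tile.all := by
  rcases τ with _ | (_ | (_ | _) | s) | _
  all_goals try decide
  fin_cases s <;> decide

/-- No module of the tile takes part in one of the patterns that are to be avoided. -/
def Tile.noBottleneck (τ : Tile) : Bool := τ.cells.all fun q => frames.all fun f =>
  !(τ.has (q + f.1 + f.2) && !τ.has (q + f.1) && !τ.has (q + f.2)) &&
  !(τ.has (q + 2 • f.1 + f.2) && !τ.has (q + f.1) && !τ.has (q + 2 • f.1) && !τ.has (q + f.2) &&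
    !τ.has (q + f.1 + f.2))

theorem Tile.noBottleneck_all : ∀ τ ∈ Tile.all, τ.noBottleneck = true := by
  decide +kernel

/-- The directions to the neighbours of lower rank. -/
def Tile.lower (τ : Tile) (q : Cell) : List Cell :=
  dirs.filter fun d => τ.has (q + d) && τ.below (q + d) q

/-- The directions to the neighbours of higher rank. -/
def Tile.upper (τ : Tile) (q : Cell) : List Cell :=
  dirs.filter fun d => τ.has (q + d) && τ.below q (q + d)

/-- Every module of the tile other than the root has exactly one neighbour of lower rank, and no
neighbour of the same rank. -/
def Tile.treeLike (τ : Tile) : Bool := τ.cells.all fun q =>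
  (decide ((τ.lower q).length = 1) || decide (τ = head) && decide (q = (6, 1)) &&
    decide (τ.lower q = [])) &&
  dirs.all fun d => !τ.has (q + d) || τ.below (q + d) q || τ.below q (q + d)

theorem Tile.treeLike_all : ∀ τ ∈ Tile.all, τ.treeLike = true := by
  decide +kernel

/-- The module at `q` can pivot in the frame `f` to the place `b`. -/
def Tile.pivots (τ : Tile) (q : Cell) (f : Cell × Cell) (b : Cell) : Bool :=
  (!τ.has (q + f.1) && !τ.has (q + f.2) && !τ.has (q + f.1 + f.2)) &&
  ((b == q + f.1 && τ.has (q - f.2) && τ.has (q + f.1 - f.2)) ||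
   (b == q + f.1 - f.2 && τ.has (q - f.2) && !τ.has (q + f.1 - f.2) && !τ.has (q + 2 • f.1) &&
      !τ.has (q + 2 • f.1 - f.2)) ||
   -- The leapfrog turn, without its condition before the move; this only enlarges the set of moves
   -- to be excluded. The inequality keeps the moving module from counting as its own neighbour.
   (b == q + f.1 && (τ.has (q - f.2) || τ.has (q + f.1 - f.2)) &&
      dirs.any fun d => decide (f.1 + d ≠ 0) && τ.has (q + (f.1 + d))))

/-- Among the modules of the tile that are leaves only a sliding module can pivot, and it remains on
its plateau. -/
def Tile.rigid (τ : Tile) : Bool := τ.cells.all fun q =>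
  (!(τ.lower q).isEmpty && !(τ.upper q).isEmpty) ||
    frames.all fun f => [q + f.1, q + f.1 - f.2].all fun b => !τ.pivots q f b ||
      [0, 1, 2].any fun s => [0, 1, 2].any fun s' => decide (τ = mid (.mob s)) &&
        (q == leaf s && b == leaf s')

theorem Tile.rigid_all : ∀ τ ∈ Tile.all, τ.rigid = true := by
  decide +kernel

theorem Tile.length_cells : Tile.head.cells.length = 32 ∧ Tile.tail.cells.length = 10 ∧
    (Tile.mid .pad).cells.length = 29 ∧ (∀ b, (Tile.mid (.bit b)).cells.length = 28) ∧
    ∀ s, (Tile.mid (.mob s)).cells.length = 27 := by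
  decide +kernel

theorem Tile.nodup_area : Tile.area.Nodup := by decide +kernel

/-! ### Seams between tiles -/

theorem Tile.has_bounds {τ : Tile} {q : Cell} (h : τ.has q = true) : -3 ≤ q.2 ∧ q.2 ≤ 8 := by
  rcases τ with _ | (_ | (_ | _) | s) | _ <;>
    simp only [Tile.has, Tile.rects, List.any_cons, List.any_nil, Bool.or_eq_true,
      Bool.and_eq_true, decide_eq_true_eq, Bool.false_eq_true, or_false] at h <;> omega

/-- Near a seam the picture does not depend on the tile, so any two tiles fit together and each may
show columns of the other. -/
theorem Tile.has_seam_right {τ : Tile} (hτ : τ ≠ tail) {x : ℤ} (h1 : 9 ≤ x) (h2 : x ≤ 12) (y : ℤ) :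
    τ.has (x, y) = true ↔ y = 0 ∨ y = 5 := by
  rcases τ with _ | (_ | (_ | _) | s) | _ <;> first
    | exact absurd rfl hτ
    | simp only [Tile.has, Tile.rects, List.any_cons, List.any_nil, Bool.or_eq_true,
        Bool.and_eq_true, decide_eq_true_eq, Bool.false_eq_true, or_false]
      omega

theorem Tile.has_seam_left {τ : Tile} (hτ : τ ≠ head) {x : ℤ} (h1 : -2 ≤ x) (h2 : x ≤ 1) (y : ℤ) :
    τ.has (x, y) = true ↔ y = 0 ∨ y = 5 := by
  rcases τ with _ | (_ | (_ | _) | s) | _ <;> first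
    | exact absurd rfl hτ
    | simp only [Tile.has, Tile.rects, List.any_cons, List.any_nil, Bool.or_eq_true,
        Bool.and_eq_true, decide_eq_true_eq, Bool.false_eq_true, or_false]
      omega

theorem Tile.head_has_nonneg {q : Cell} (h : head.has q = true) : 0 ≤ q.1 := by
  simp only [Tile.has, Tile.rects, List.any_cons, List.any_nil, Bool.or_eq_true,
    Bool.and_eq_true, decide_eq_true_eq, Bool.false_eq_true, or_false] at h
  omega

theorem Tile.tail_has_le {q : Cell} (h : tail.has q = true) : q.1 ≤ 2 := by
  simp only [Tile.has, Tile.rects, List.any_cons, List.any_nil, Bool.or_eq_true,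
    Bool.and_eq_true, decide_eq_true_eq, Bool.false_eq_true, or_false] at h
  omega

/-- Both tiles at a seam assign the same ranks there, so ranks can be compared across it. -/
theorem Tile.rank_seam_right {τ : Tile} (hτ : τ ≠ tail) {x : ℤ} (h1 : 9 ≤ x) (h2 : x ≤ 12)
    (X y : ℤ) : τ.rank X (x, y) = if 2 ≤ y then toLex (1, -32 * X + y) else toLex (0, 32 * X + y) := by
  have hp : τ.part (x, y) = if 2 ≤ y then 1 else 0 := by
    unfold Tile.part
    rw [if_neg (by simp only; omega), if_neg (by tauto)]
  have hh : τ.height (x, y) = y := by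
    rcases τ with _ | (_ | (_ | _) | s) | _ <;> simp only [Tile.height] <;> split_ifs <;> omega
  rw [Tile.rank, hp, hh]
  split_ifs <;> simp_all

theorem Tile.rank_seam_left {τ : Tile} (hτ : τ ≠ head) {x : ℤ} (h1 : -2 ≤ x) (h2 : x ≤ 1)
    (X y : ℤ) : τ.rank X (x, y) = if 2 ≤ y then toLex (1, -32 * X + y) else toLex (0, 32 * X + y) := by
  have hp : τ.part (x, y) = if 2 ≤ y then 1 else 0 := by
    unfold Tile.part
    rw [if_neg (by tauto), if_neg (by simp only; omega)]
  have hh : τ.height (x, y) = y := by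
    rcases τ with _ | (_ | (_ | _) | s) | _ <;> first
      | exact absurd rfl hτ
      | simp only [Tile.height] <;> split_ifs <;> omega
  rw [Tile.rank, hp, hh]
  split_ifs <;> simp_all

/-! ### Configurations assembled from tiles -/

variable {k : ℕ}

/-- The tile at position `i` of the configuration given by `w`. -/
def tileAt (w : Fin k → Mid) (i : ℤ) : Option Tile :=
  if i = 0 then some .head
  else if h : 1 ≤ i ∧ i ≤ k then some (.mid (w ⟨(i - 1).toNat, by omega⟩))
  else if i = k + 1 then some .tail else none

theorem tileAt_zero (w : Fin k → Mid) : tileAt w 0 = some .head := rfl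

theorem tileAt_last (w : Fin k → Mid) : tileAt w (k + 1) = some .tail := by
  unfold tileAt
  rw [if_neg (by omega), dif_neg (by omega), if_pos rfl]

theorem tileAt_mid (w : Fin k → Mid) (i : Fin k) : tileAt w (i + 1) = some (.mid (w i)) := by
  unfold tileAt
  rw [if_neg (by omega), dif_pos (by omega)]
  simp

theorem tileAt_cases {w : Fin k → Mid} {i : ℤ} {τ : Tile} (h : tileAt w i = some τ) :
    (i = 0 ∧ τ = .head) ∨ (∃ j : Fin k, i = j + 1 ∧ τ = .mid (w j)) ∨ (i = k + 1 ∧ τ = .tail) := by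
  unfold tileAt at h
  split_ifs at h with h1 h2 h3
  · exact Or.inl ⟨h1, (Option.some.inj h).symm⟩
  · exact Or.inr (Or.inl ⟨⟨(i - 1).toNat, by omega⟩, by simp; omega, (Option.some.inj h).symm⟩)
  · exact Or.inr (Or.inr ⟨h3, (Option.some.inj h).symm⟩)

theorem tileAt_bounds {w : Fin k → Mid} {i : ℤ} {τ : Tile} (h : tileAt w i = some τ) :
    0 ≤ i ∧ i ≤ k + 1 := by
  rcases tileAt_cases h with ⟨rfl, _⟩ | ⟨j, rfl, _⟩ | ⟨rfl, _⟩ <;> omega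

theorem tileAt_isSome (w : Fin k → Mid) {i : ℤ} (h0 : 0 ≤ i) (h1 : i ≤ k + 1) :
    ∃ τ, tileAt w i = some τ := by
  unfold tileAt
  split_ifs <;> first | exact ⟨_, rfl⟩ | omega

theorem tileAt_eq_head {w : Fin k → Mid} {i : ℤ} (h : tileAt w i = some .head) : i = 0 := by
  rcases tileAt_cases h with ⟨h, _⟩ | ⟨j, _, h⟩ | ⟨_, h⟩ <;> simp_all

theorem tileAt_eq_tail {w : Fin k → Mid} {i : ℤ} (h : tileAt w i = some .tail) : i = k + 1 := by
  rcases tileAt_cases h with ⟨_, h⟩ | ⟨j, _, h⟩ | ⟨h, _⟩ <;> simp_all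

/-- The configuration made of the first tile, the tiles `w` and the last tile. -/
noncomputable def assemble (w : Fin k → Mid) : Finset Cell :=
  -- The box spans tiles 0 to `k + 1`, the last of which ends at column `11 * (k + 1) + 10`. It only
  -- serves to make the set finite.
  (Finset.Icc ((0, -3) : Cell) (11 * k + 21, 8)).filter fun p =>
    (tileAt w (p.1 / 11)).any fun τ => τ.has (p.1 % 11, p.2)

theorem mem_assemble {w : Fin k → Mid} {p : Cell} :
    p ∈ assemble w ↔ ∃ τ, tileAt w (p.1 / 11) = some τ ∧ τ.has (p.1 % 11, p.2) = true := by
  simp only [assemble, Finset.mem_filter, Finset.mem_Icc, Option.any_eq_true]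
  refine ⟨fun h => h.2, fun h => ⟨?_, h⟩⟩
  obtain ⟨τ, h1, h2⟩ := h
  have hb := Tile.has_bounds h2
  have := tileAt_bounds h1
  simp only [Prod.le_def]
  simp only at hb
  omega

theorem mem_assemble_iff {w : Fin k → Mid} {i : ℤ} {τ : Tile} (h : tileAt w i = some τ) {x y : ℤ}
    (h0 : 0 ≤ x) (h1 : x ≤ 10) : (11 * i + x, y) ∈ assemble w ↔ τ.has (x, y) = true := by
  rw [mem_assemble]
  have e1 : (11 * i + x) / 11 = i := by omega
  have e2 : (11 * i + x) % 11 = x := by omega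
  simp only [e1, e2, h, Option.some.injEq]
  exact ⟨fun ⟨_, rfl, h⟩ => h, fun h => ⟨_, rfl, h⟩⟩

/-- The picture of a tile shows two columns of the adjacent tiles. -/
theorem mem_assemble_iff_has {w : Fin k → Mid} {i : ℤ} {τ : Tile} (h : tileAt w i = some τ) {x y : ℤ}
    (h0 : -2 ≤ x) (h1 : x ≤ 12) : (11 * i + x, y) ∈ assemble w ↔ τ.has (x, y) = true := by
  have hb := tileAt_bounds h
  rcases lt_or_ge x 0 with hx | hx
  · rcases hb.1.eq_or_lt with rfl | hi
    · obtain rfl : τ = .head := (Option.some.inj h).symm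
      refine ⟨fun h => ?_, fun h => absurd (Tile.head_has_nonneg h) (by simpa using hx)⟩
      obtain ⟨_, h, _⟩ := mem_assemble.1 h
      have := tileAt_bounds h
      simp only at this
      omega
    · obtain ⟨τ', h'⟩ := tileAt_isSome w (i := i - 1) (by omega) (by omega)
      rw [show 11 * i + x = 11 * (i - 1) + (x + 11) by ring,
        mem_assemble_iff h' (by omega) (by omega),
        Tile.has_seam_right (by rintro rfl; have := tileAt_eq_tail h'; omega) (by omega) (by omega),
        Tile.has_seam_left (by rintro rfl; have := tileAt_eq_head h; omega) (by omega) (by omega)]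
  rcases lt_or_ge 10 x with hx' | hx'
  · rcases hb.2.eq_or_lt with rfl | hi
    · obtain rfl : τ = .tail := by
        rw [tileAt_last] at h
        exact (Option.some.inj h).symm
      refine ⟨fun h => ?_, fun h => absurd (Tile.tail_has_le h) (by simp only; omega)⟩
      obtain ⟨_, h, _⟩ := mem_assemble.1 h
      have := tileAt_bounds h
      simp only at this
      omega
    · obtain ⟨τ', h'⟩ := tileAt_isSome w (i := i + 1) (by omega) (by omega)
      rw [show 11 * i + x = 11 * (i + 1) + (x - 11) by ring,
        mem_assemble_iff h' (by omega) (by omega),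
        Tile.has_seam_left (by rintro rfl; have := tileAt_eq_head h'; omega) (by omega) (by omega),
        Tile.has_seam_right (by rintro rfl; have := tileAt_eq_tail h; omega) (by omega) (by omega)]
  · exact mem_assemble_iff h hx hx'

/-- The rank of a cell, which increases along the path. -/
def rankOf (w : Fin k → Mid) (p : Cell) : ℤ ×ₗ ℤ :=
  -- The default is immaterial, since every module lies in a tile.
  ((tileAt w (p.1 / 11)).getD .head).rank p.1 (p.1 % 11, p.2)

theorem rankOf_eq {w : Fin k → Mid} {i : ℤ} {τ : Tile} (h : tileAt w i = some τ) {x y : ℤ}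
    (h0 : -1 ≤ x) (h1 : x ≤ 11) (hp : (11 * i + x, y) ∈ assemble w) :
    rankOf w (11 * i + x, y) = τ.rank (11 * i + x) (x, y) := by
  have inner : ∀ {i : ℤ} {τ : Tile} (h : tileAt w i = some τ) {x : ℤ}, 0 ≤ x → x ≤ 10 →
      rankOf w (11 * i + x, y) = τ.rank (11 * i + x) (x, y) := by
    intro i τ h x h0 h1
    have e1 : (11 * i + x) / 11 = i := by omega
    have e2 : (11 * i + x) % 11 = x := by omega
    simp only [rankOf, e1, e2, h, Option.getD_some]
  obtain ⟨τ', h', -⟩ := mem_assemble.1 hp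
  rcases lt_or_ge x 0 with hx | hx
  · rw [show (11 * i + x) / 11 = i - 1 by omega] at h'
    have := tileAt_bounds h
    have := tileAt_bounds h'
    rw [show 11 * i + x = 11 * (i - 1) + (x + 11) by ring, inner h' (by omega) (by omega),
      Tile.rank_seam_right (by rintro rfl; have := tileAt_eq_tail h'; omega) (by omega) (by omega),
      Tile.rank_seam_left (by rintro rfl; have := tileAt_eq_head h; omega) (by omega) (by omega)]
  rcases lt_or_ge 10 x with hx' | hx'
  · rw [show (11 * i + x) / 11 = i + 1 by omega] at h'
    have := tileAt_bounds h
    have := tileAt_bounds h'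
    rw [show 11 * i + x = 11 * (i + 1) + (x - 11) by ring, inner h' (by omega) (by omega),
      Tile.rank_seam_left (by rintro rfl; have := tileAt_eq_head h'; omega) (by omega) (by omega),
      Tile.rank_seam_right (by rintro rfl; have := tileAt_eq_tail h; omega) (by omega) (by omega)]
  · exact inner h hx hx'

/-- Within a part, moving a tile by `11 * i` columns adds the same constant to both ranks. -/
theorem Tile.rank_lt_iff (τ : Tile) (i : ℤ) (q q' : Cell) :
    τ.rank (11 * i + q.1) q < τ.rank (11 * i + q'.1) q' ↔ τ.below q q' = true := by
  simp only [Tile.rank, Tile.below, Prod.Lex.toLex_lt_toLex, Bool.or_eq_true, Bool.and_eq_true,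
    decide_eq_true_eq]
  refine or_congr Iff.rfl (and_congr_right fun h => ?_)
  rw [← h]
  split_ifs <;> constructor <;> intro h <;> linarith

theorem Tile.mem_area {q : Cell} :
    q ∈ Tile.area ↔ 0 ≤ q.1 ∧ q.1 ≤ 10 ∧ -3 ≤ q.2 ∧ q.2 ≤ 8 := by
  obtain ⟨x, y⟩ := q
  simp only [Tile.area, List.mem_flatMap, List.mem_map, Prod.mk.injEq, List.mem_cons,
    List.not_mem_nil, or_false]
  constructor
  · rintro ⟨x', hx, y', hy, rfl, rfl⟩
    omega
  · rintro h
    exact ⟨x, by omega, y, by omega, rfl, rfl⟩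

theorem Tile.mem_cells {τ : Tile} {q : Cell} :
    q ∈ τ.cells ↔ 0 ≤ q.1 ∧ q.1 ≤ 10 ∧ τ.has q = true := by
  rw [Tile.cells, List.mem_filter, Tile.mem_area]
  constructor
  · tauto
  · rintro ⟨h1, h2, h3⟩
    have := Tile.has_bounds h3
    tauto

/-- Near the module at `p` the configuration looks like the tile `τ` near `q`. -/
structure LooksLike (w : Fin k → Mid) (p : Cell) (τ : Tile) (q : Cell) : Prop where
  tileAt_eq : tileAt w (p.1 / 11) = some τ
  mem_cells : q ∈ τ.cells
  eq : q = (p.1 % 11, p.2)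
  -- Moves and patterns reach two columns away; ranks are compared only among neighbours.
  mem_iff : ∀ d : Cell, |d.1| ≤ 2 → (p + d ∈ assemble w ↔ τ.has (q + d) = true)
  lt_iff : ∀ d d' : Cell, |d.1| ≤ 1 → |d'.1| ≤ 1 → p + d ∈ assemble w → p + d' ∈ assemble w →
    (rankOf w (p + d) < rankOf w (p + d') ↔ τ.below (q + d) (q + d') = true)

theorem exists_looksLike {w : Fin k → Mid} {p : Cell} (hp : p ∈ assemble w) :
    ∃ τ q, LooksLike w p τ q := by
  obtain ⟨τ, h1, h2⟩ := mem_assemble.1 hp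
  have e : ∀ d : Cell, p + d = (11 * (p.1 / 11) + (((p.1 % 11, p.2) : Cell) + d).1,
      (((p.1 % 11, p.2) : Cell) + d).2) := by
    intro d
    ext
    · simp only [Prod.fst_add]
      omega
    · rfl
  refine ⟨τ, (p.1 % 11, p.2), h1, ?_, rfl, ?_, ?_⟩
  · rw [Tile.mem_cells]
    exact ⟨by simp only; omega, by simp only; omega, h2⟩
  · intro d hd
    rw [abs_le] at hd
    rw [e d]
    refine mem_assemble_iff_has h1 ?_ ?_ <;> simp only [Prod.fst_add] <;> omega
  · intro d d' hd hd' hm hm'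
    rw [abs_le] at hd hd'
    rw [e d] at hm ⊢
    rw [e d'] at hm' ⊢
    rw [rankOf_eq h1 _ _ hm, rankOf_eq h1 _ _ hm', Tile.rank_lt_iff] <;>
      simp only [Prod.fst_add] <;> omega

/-! ### Assembled configurations are trees -/

theorem add_mem_dirs_fst {d : Cell} (hd : d ∈ dirs) : |d.1| ≤ 1 := by
  revert d
  decide

namespace LooksLike

variable {w : Fin k → Mid} {p q : Cell} {τ : Tile}

theorem mem_lower_iff (h : LooksLike w p τ q) (hp : p ∈ assemble w) {d : Cell} :
    d ∈ τ.lower q ↔ d ∈ dirs ∧ p + d ∈ assemble w ∧ rankOf w (p + d) < rankOf w p := by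
  simp only [Tile.lower, List.mem_filter, Bool.and_eq_true]
  refine and_congr_right fun hd => ?_
  have h1 := add_mem_dirs_fst hd
  rw [← h.mem_iff d (by omega)]
  refine and_congr_right fun hm => ?_
  have := h.lt_iff d 0 h1 (by simp) hm (by simpa using hp)
  rw [add_zero, add_zero] at this
  exact this.symm

theorem mem_upper_iff (h : LooksLike w p τ q) (hp : p ∈ assemble w) {d : Cell} :
    d ∈ τ.upper q ↔ d ∈ dirs ∧ p + d ∈ assemble w ∧ rankOf w p < rankOf w (p + d) := by
  simp only [Tile.upper, List.mem_filter, Bool.and_eq_true]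
  refine and_congr_right fun hd => ?_
  have h1 := add_mem_dirs_fst hd
  rw [← h.mem_iff d (by omega)]
  refine and_congr_right fun hm => ?_
  have := h.lt_iff 0 d (by simp) h1 (by simpa using hp) hm
  rw [add_zero, add_zero] at this
  exact this.symm

end LooksLike

theorem Tile.lower_of_mem {τ : Tile} {q : Cell} (hq : q ∈ τ.cells) :
    ((τ.lower q).length = 1 ∨ τ = head ∧ q = (6, 1) ∧ τ.lower q = []) ∧
    ∀ d ∈ dirs, τ.has (q + d) = true → τ.below (q + d) q = true ∨ τ.below q (q + d) = true := by
  have h := Tile.treeLike_all τ τ.mem_all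
  rw [Tile.treeLike, List.all_eq_true] at h
  have h := h q hq
  simp only [Bool.and_eq_true, Bool.or_eq_true, decide_eq_true_eq, List.all_eq_true,
    Bool.not_eq_true'] at h
  refine ⟨h.1.imp_right fun h => ⟨h.1.1, h.1.2, h.2⟩, fun d hd hm => ?_⟩
  have := h.2 d hd
  simpa [hm] using this

theorem rankOf_ne {w : Fin k → Mid} {p q : Cell} (hp : p ∈ assemble w) (hq : q ∈ assemble w)
    (h : FacetAdj p q) : rankOf w p ≠ rankOf w q := by
  obtain ⟨d, hd, rfl⟩ := facetAdj_iff.1 h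
  obtain ⟨τ, c, hL⟩ := exists_looksLike hp
  have hm := (hL.mem_iff d (by have := add_mem_dirs_fst hd; omega)).1 hq
  rcases (Tile.lower_of_mem hL.mem_cells).2 d hd hm with h | h
  · exact ((hL.mem_lower_iff hp).1 (List.mem_filter.2 ⟨hd, by simp [hm, h]⟩)).2.2.ne'
  · exact ((hL.mem_upper_iff hp).1 (List.mem_filter.2 ⟨hd, by simp [hm, h]⟩)).2.2.ne

theorem lower_neighbor_unique {w : Fin k → Mid} {p q q' : Cell} (hp : p ∈ assemble w)
    (hq : q ∈ assemble w) (hq' : q' ∈ assemble w) (h : FacetAdj p q) (h' : FacetAdj p q')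
    (hlt : rankOf w q < rankOf w p) (hlt' : rankOf w q' < rankOf w p) : q = q' := by
  obtain ⟨d, hd, rfl⟩ := facetAdj_iff.1 h
  obtain ⟨d', hd', rfl⟩ := facetAdj_iff.1 h'
  obtain ⟨τ, c, hL⟩ := exists_looksLike hp
  have h1 := (hL.mem_lower_iff hp).2 ⟨hd, hq, hlt⟩
  have h2 := (hL.mem_lower_iff hp).2 ⟨hd', hq', hlt'⟩
  rcases (Tile.lower_of_mem hL.mem_cells).1 with h | ⟨-, -, h⟩
  · obtain ⟨x, hx⟩ := List.length_eq_one_iff.1 h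
    rw [hx, List.mem_singleton] at h1 h2
    rw [h1, h2]
  · simp [h] at h1

theorem exists_lower_neighbor {w : Fin k → Mid} {p : Cell} (hp : p ∈ assemble w) (hne : p ≠ (6, 1)) :
    ∃ q ∈ assemble w, FacetAdj p q ∧ rankOf w q < rankOf w p := by
  obtain ⟨τ, c, hL⟩ := exists_looksLike hp
  rcases (Tile.lower_of_mem hL.mem_cells).1 with h | ⟨rfl, rfl, -⟩
  · obtain ⟨d, hd⟩ := List.length_eq_one_iff.1 h
    have := (hL.mem_lower_iff hp).1 (hd ▸ List.mem_singleton_self d)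
    exact ⟨p + d, this.2.1, facetAdj_add this.1, this.2.2⟩
  · have h0 := tileAt_eq_head hL.tileAt_eq
    have h1 := hL.eq
    rw [Prod.mk.injEq] at h1
    exact absurd (Prod.ext (by simp only; omega) h1.2.symm) hne

theorem root_mem (w : Fin k → Mid) : ((6, 1) : Cell) ∈ assemble w :=
  (mem_assemble_iff (tileAt_zero w) (x := 6) (by norm_num) (by norm_num)).2 (by decide)

theorem facetConnected_assemble (w : Fin k → Mid) : FacetConnected (assemble w) :=
  facetConnected_of_rank (rankOf w) (root_mem w) fun _ hp hne => exists_lower_neighbor hp hne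

/-- A cell without upper neighbours is nobody's parent, so all others keep their descent to the
root. -/
theorem facetConnected_assemble_erase {w : Fin k → Mid} {p : Cell} (hp : p ∈ assemble w)
    (hne : p ≠ (6, 1)) {τ : Tile} {q : Cell} (hL : LooksLike w p τ q) (hu : τ.upper q = []) :
    FacetConnected ((assemble w).erase p) := by
  refine facetConnected_of_rank (rankOf w) (Finset.mem_erase.2 ⟨hne.symm, root_mem w⟩)
    fun x hx hne => ?_
  rw [Finset.mem_erase] at hx
  obtain ⟨y, hy, hxy, hlt⟩ := exists_lower_neighbor hx.2 hne
  refine ⟨y, Finset.mem_erase.2 ⟨?_, hy⟩, hxy, hlt⟩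
  rintro rfl
  obtain ⟨d, hd, rfl⟩ := facetAdj_iff.1 hxy.symm
  have := (hL.mem_upper_iff hp).2 ⟨hd, hx.2, hlt⟩
  simp [hu] at this

theorem not_facetConnected_assemble_erase {w : Fin k → Mid} {p : Cell} (hp : p ∈ assemble w)
    {τ : Tile} {q : Cell} (hL : LooksLike w p τ q) (hl : τ.lower q ≠ []) (hu : τ.upper q ≠ []) :
    ¬ FacetConnected ((assemble w).erase p) := by
  obtain ⟨d, hd⟩ := List.exists_mem_of_ne_nil _ hl
  obtain ⟨e, he⟩ := List.exists_mem_of_ne_nil _ hu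
  rw [hL.mem_lower_iff hp] at hd
  rw [hL.mem_upper_iff hp] at he
  exact not_facetConnected_erase (rankOf w) (fun _ hp _ hq h => rankOf_ne hp hq h)
    (fun _ hp _ hq _ hq' h h' hlt hlt' => lower_neighbor_unique hp hq hq' h h' hlt hlt') hp
    hd.2.1 he.2.1 (facetAdj_add hd.1) (facetAdj_add he.1) hd.2.2 he.2.2

/-! ### Patterns in assembled configurations -/

theorem Frame.fst_le {u v : Cell} (h : Frame u v) : ∀ d ∈ [u, v, u + v, -v, u - v, 2 • u,
    2 • u + v, 2 • u - v], |d.1| ≤ 2 := by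
  have key : ∀ f ∈ frames, ∀ d ∈ [f.1, f.2, f.1 + f.2, -f.2, f.1 - f.2, 2 • f.1,
      2 • f.1 + f.2, 2 • f.1 - f.2], |d.1| ≤ 2 := by decide
  exact key (u, v) (frame_iff.1 h)

theorem Tile.noBottleneck_of_mem {τ : Tile} {q : Cell} (hq : q ∈ τ.cells) {u v : Cell}
    (hf : Frame u v) :
    ¬ (τ.has (q + (u + v)) = true ∧ ¬ τ.has (q + u) = true ∧ ¬ τ.has (q + v) = true) ∧
    ¬ (τ.has (q + (2 • u + v)) = true ∧ ¬ τ.has (q + u) = true ∧ ¬ τ.has (q + 2 • u) = true ∧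
      ¬ τ.has (q + v) = true ∧ ¬ τ.has (q + (u + v)) = true) := by
  have h := Tile.noBottleneck_all τ τ.mem_all
  rw [Tile.noBottleneck, List.all_eq_true] at h
  have h := h q hq
  rw [List.all_eq_true] at h
  have h := h (u, v) (frame_iff.1 hf)
  simp only [add_assoc, Bool.and_eq_true, Bool.not_eq_true', Bool.and_eq_false_iff] at h
  refine ⟨?_, ?_⟩
  · rintro ⟨h1, h2, h3⟩
    simp [h1, h2, h3] at h
  · rintro ⟨h1, h2, h3, h4, h5⟩
    simp [-nsmul_eq_mul, h1, h2, h3, h4, h5] at h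

theorem not_hasPatternGamma_assemble (w : Fin k → Mid) : ¬ HasPatternGamma (assemble w) := by
  rintro ⟨p, u, v, hf, h1, h2, h3, h4⟩
  obtain ⟨τ, q, hL⟩ := exists_looksLike h1
  have hd := hf.fst_le
  rw [add_assoc, hL.mem_iff _ (hd _ (by simp))] at h2
  rw [hL.mem_iff _ (hd _ (by simp))] at h3 h4
  exact (Tile.noBottleneck_of_mem hL.mem_cells hf).1 ⟨h2, h3, h4⟩

theorem not_hasPatternZ_assemble (w : Fin k → Mid) : ¬ HasPatternZ (assemble w) := by
  rintro ⟨p, u, v, hf, h1, h2, h3, h4, h5, h6⟩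
  obtain ⟨τ, q, hL⟩ := exists_looksLike h1
  have hd := hf.fst_le
  rw [add_assoc, hL.mem_iff _ (hd _ (by simp))] at h2 h6
  rw [hL.mem_iff _ (hd _ (by simp))] at h3 h4 h5
  exact (Tile.noBottleneck_of_mem hL.mem_cells hf).2 ⟨h2, h3, h4, h5, h6⟩

theorem head_mem_iff (w : Fin k → Mid) {x : ℤ} (h0 : 0 ≤ x) (h1 : x ≤ 10) (y : ℤ) :
    ((x, y) : Cell) ∈ assemble w ↔ Tile.head.has (x, y) = true := by
  simpa using mem_assemble_iff (tileAt_zero w) h0 h1 (y := y)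

theorem hasPatternI_assemble (w : Fin k → Mid) : HasPatternI (assemble w) := by
  refine ⟨(0, 0), (1, 0), (0, 1), frame_iff.2 (by decide), ?_, ?_, ?_⟩
  · exact (head_mem_iff w (by norm_num) (by norm_num) 0).2 (by decide)
  · exact (head_mem_iff w (x := 2) (by norm_num) (by norm_num) 0).2 (by decide)
  · exact fun h => absurd ((head_mem_iff w (x := 1) (by norm_num) (by norm_num) 0).1 h) (by decide)

/-! ### Moves of assembled configurations -/

/-- The place of the sliding module of the tile `i + 1` in state `s`. -/
def slider (i : Fin k) (s : Fin 3) : Cell := (11 * (i + 1) + (4 + s.val), 6)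

theorem Tile.mob_has_iff (s s' : Fin 3) (q : Cell) :
    (mid (.mob s')).has q = true ↔ q = leaf s' ∨ (q ≠ leaf s ∧ (mid (.mob s)).has q = true) := by
  have key : ∃ B : Prop, (B → q.2 ≤ 5) ∧ ∀ t, (mid (.mob t)).has q = true ↔ q = leaf t ∨ B := by
    -- The first ten rectangles do not depend on the state and stay below row 6; the eleventh is the
    -- slider.
    refine ⟨((mid (.mob 0)).rects.take 10).any (fun R => decide (R.1.1 ≤ q.1) &&
      decide (q.1 ≤ R.1.2) && (decide (R.2.1 ≤ q.2) && decide (q.2 ≤ R.2.2))) = true, ?_, ?_⟩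
    · simp only [Tile.rects, List.take, List.any_cons, List.any_nil, Bool.or_eq_true,
        Bool.and_eq_true, decide_eq_true_eq, Bool.false_eq_true, or_false]
      omega
    · intro t
      have hl : q = leaf t ↔ (4 + (t.val : ℤ) ≤ q.1 ∧ q.1 ≤ 4 + t.val) ∧ 6 ≤ q.2 ∧ q.2 ≤ 6 := by
        simp only [leaf, Prod.ext_iff]
        omega
      rw [hl, or_comm]
      simp only [Tile.has, Tile.rects, List.take, List.any_cons, List.any_nil, Bool.or_eq_true,
        Bool.and_eq_true, decide_eq_true_eq, Bool.false_eq_true, or_false, or_assoc]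
  obtain ⟨B, hB, h⟩ := key
  have hne : B → q ≠ leaf s := by
    rintro hb rfl
    exact absurd (hB hb) (by simp [leaf])
  rw [h s', h s]
  tauto

theorem tileAt_update_of_ne (w : Fin k → Mid) (j : Fin k) (m : Mid) {i : ℤ} (h : i ≠ j + 1) :
    tileAt (Function.update w j m) i = tileAt w i := by
  unfold tileAt
  split_ifs with h1 h2 h3 <;> try rfl
  rw [Function.update_of_ne]
  rintro rfl
  simp only at h
  omega

theorem assemble_update {w : Fin k → Mid} {j : Fin k} {s : Fin 3} (hw : w j = .mob s)
    (s' : Fin 3) : assemble (Function.update w j (.mob s')) =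
      insert (slider j s') ((assemble w).erase (slider j s)) := by
  ext p
  rw [Finset.mem_insert, Finset.mem_erase]
  have hs := s.isLt
  have hs' := s'.isLt
  by_cases hp : p.1 / 11 = j + 1
  · have t1 := tileAt_mid (Function.update w j (.mob s')) j
    have t2 := tileAt_mid w j
    rw [Function.update_self] at t1
    rw [hw] at t2
    have key : ∀ t, p = slider j t ↔ ((p.1 % 11, p.2) : Cell) = leaf t := by
      intro t
      have := t.isLt
      simp only [slider, leaf, Prod.ext_iff]
      omega
    rw [Ne, key, key, ← Ne]
    simp only [mem_assemble, hp, t1, t2, Option.some.injEq, exists_eq_left']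
    exact Tile.mob_has_iff s s' _
  · have key : ∀ t, p ≠ slider j t := by
      rintro t rfl
      have := t.isLt
      simp only [slider] at hp
      omega
    simp only [mem_assemble, tileAt_update_of_ne w j _ hp, key, false_or, ne_eq, not_false_eq_true,
      true_and]

theorem Tile.rigid_of_mem {τ : Tile} {q : Cell} (hq : q ∈ τ.cells)
    (h : τ.lower q = [] ∨ τ.upper q = []) {u v b : Cell} (hf : Frame u v)
    (hb : b = q + u ∨ b = q + u - v) (hp : τ.pivots q (u, v) b = true) :
    ∃ s s', τ = mid (.mob s) ∧ q = leaf s ∧ b = leaf s' := by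
  have hr := Tile.rigid_all τ τ.mem_all
  rw [Tile.rigid, List.all_eq_true] at hr
  have hr := hr q hq
  rw [Bool.or_eq_true, List.all_eq_true] at hr
  rcases hr with hr | hr
  · rcases h with h | h <;> simp [h] at hr
  · have hr := hr (u, v) (frame_iff.1 hf)
    rw [List.all_eq_true] at hr
    have hr := hr b (by simpa using hb)
    rw [hp] at hr
    simp only [Bool.not_true, Bool.false_or, List.any_eq_true, Bool.and_eq_true, decide_eq_true_eq,
      beq_iff_eq] at hr
    obtain ⟨s, -, s', -, h1, h2, h3⟩ := hr
    exact ⟨s, s', h1, h2, h3⟩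

/-- One test in the picture covers both sets of moves, as the restrictive moves are also leapfrog
moves. -/
theorem LooksLike.pivots {M : MoveSet} {w : Fin k → Mid} {a b q : Cell} {τ : Tile}
    (hL : LooksLike w a τ q) (h : CanPivot M (assemble w) a b) :
    ∃ u v, Frame u v ∧ (q + (b - a) = q + u ∨ q + (b - a) = q + u - v) ∧
      τ.pivots q (u, v) (q + (b - a)) = true := by
  have h : RestrictivePivot (assemble w) a b ∨ LeapfrogQuarterTurn (assemble w) a b := by
    cases M
    · exact Or.inl h
    · exact h
  rcases h with ⟨u, v, hf, hs, h⟩ | ⟨⟨u, v, hf, hs, hq, rfl⟩, -, ⟨t, ht, hat⟩⟩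
  · have hd := hf.fst_le
    have m1 := hL.mem_iff u (hd _ (by simp))
    have m2 := hL.mem_iff v (hd _ (by simp))
    have m3 := hL.mem_iff (u + v) (hd _ (by simp))
    have m4 := hL.mem_iff (-v) (hd _ (by simp))
    have m5 := hL.mem_iff (u - v) (hd _ (by simp))
    have m6 := hL.mem_iff (2 • u) (hd _ (by simp))
    have m7 := hL.mem_iff (2 • u - v) (hd _ (by simp))
    rw [← add_assoc, ← add_assoc] at m3
    rw [← sub_eq_add_neg, ← sub_eq_add_neg] at m4
    rw [← add_sub_assoc, ← add_sub_assoc] at m5 m7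
    refine ⟨u, v, hf, ?_⟩
    rcases h with ⟨hs', ⟨h1, h2, h3⟩, rfl⟩ | ⟨⟨⟨h1, h2, h3⟩, h4, h5, h6⟩, rfl⟩
    · rw [show q + (a + u - a) = q + u by abel]
      refine ⟨Or.inl rfl, ?_⟩
      rw [m1, Bool.not_eq_true] at h1
      rw [m2, Bool.not_eq_true] at h2
      rw [m3, Bool.not_eq_true] at h3
      rw [m4] at hs
      rw [m5] at hs'
      simp [Tile.pivots, h1, h2, h3, hs, hs']
    · rw [show q + (a + u - v - a) = q + u - v by abel]
      refine ⟨Or.inr rfl, ?_⟩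
      rw [m1, Bool.not_eq_true] at h1
      rw [m2, Bool.not_eq_true] at h2
      rw [m3, Bool.not_eq_true] at h3
      rw [m5, Bool.not_eq_true] at h4
      rw [m6, Bool.not_eq_true] at h5
      rw [m7, Bool.not_eq_true] at h6
      rw [m4] at hs
      simp only [Tile.pivots, h1, h2, h3, h4, h5, h6, hs]
      simp
  · have hd := hf.fst_le
    have m1 := hL.mem_iff u (hd _ (by simp))
    have m2 := hL.mem_iff v (hd _ (by simp))
    have m3 := hL.mem_iff (u + v) (hd _ (by simp))
    have m4 := hL.mem_iff (-v) (hd _ (by simp))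
    have m5 := hL.mem_iff (u - v) (hd _ (by simp))
    rw [← add_assoc, ← add_assoc] at m3
    rw [← sub_eq_add_neg, ← sub_eq_add_neg] at m4
    rw [← add_sub_assoc, ← add_sub_assoc] at m5
    obtain ⟨h1, h2, h3⟩ := hq
    refine ⟨u, v, hf, ?_⟩
    rw [show q + (a + u - a) = q + u by abel]
    refine ⟨Or.inl rfl, ?_⟩
    rw [m1, Bool.not_eq_true] at h1
    rw [m2, Bool.not_eq_true] at h2
    rw [m3, Bool.not_eq_true] at h3
    rw [m4, m5] at hs
    obtain ⟨d, hdd, rfl⟩ := facetAdj_iff.1 hat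
    rw [Finset.mem_erase, add_assoc] at ht
    have hle : |(u + d).1| ≤ 2 := by
      have e1 := add_mem_dirs_fst hdd
      have e2 := add_mem_dirs_fst (mem_dirs.2 hf.1)
      rw [abs_le] at e1 e2 ⊢
      simp only [Prod.fst_add]
      omega
    have ht2 := (hL.mem_iff _ hle).1 ht.2
    have hne : u + d ≠ 0 := fun h => ht.1 (by rw [h, add_zero])
    have hany : (dirs.any fun d => decide (u + d ≠ 0) && τ.has (q + (u + d))) = true :=
      List.any_eq_true.2 ⟨d, hdd, by simp [hne, ht2]⟩
    simp only [Tile.pivots, h1, h2, h3, hany, Bool.or_eq_true, Bool.and_eq_true, hs]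
    simp

/-- The tile without the state of its sliding module. -/
def Mid.skeleton : Mid → Mid
  | .mob _ => .mob 0
  | m => m

/-- Every move of an assembled configuration moves a sliding module. -/
theorem PivotMove.exists_eq_assemble {M : MoveSet} {w : Fin k → Mid} {D : Finset Cell}
    (h : PivotMove M (assemble w) D) :
    ∃ w' : Fin k → Mid, (∀ i, (w' i).skeleton = (w i).skeleton) ∧ D = assemble w' := by
  obtain ⟨a, ha, b, hp, hc, rfl⟩ := h
  obtain ⟨τ, q, hL⟩ := exists_looksLike ha
  obtain ⟨u, v, hf, hb, hpiv⟩ := hL.pivots hp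
  -- The remaining modules are connected, so `a` is not a cut vertex of the tree.
  have hleaf : τ.lower q = [] ∨ τ.upper q = [] := by
    by_contra! hcon
    exact not_facetConnected_assemble_erase ha hL hcon.1 hcon.2 hc
  obtain ⟨s, s', rfl, rfl, hbl⟩ := Tile.rigid_of_mem hL.mem_cells hleaf hf hb hpiv
  rcases tileAt_cases hL.tileAt_eq with ⟨_, h⟩ | ⟨j, hj, h⟩ | ⟨_, h⟩
  · cases h
  · have hwj : w j = .mob s := by
      injection h with h
      exact h.symm
    have hq := hL.eq
    rw [leaf, Prod.mk.injEq] at hq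
    have hsl : a = slider j s := Prod.ext (by simp only [slider]; omega) hq.2.symm
    have hsl' : b = slider j s' := by
      rw [Prod.ext_iff] at hbl hsl ⊢
      simp only [leaf, slider, Prod.fst_add, Prod.snd_add, Prod.fst_sub, Prod.snd_sub] at hbl hsl ⊢
      omega
    refine ⟨Function.update w j (.mob s'), fun i => ?_, ?_⟩
    · rcases eq_or_ne i j with rfl | hne
      · rw [Function.update_self, hwj]
        rfl
      · rw [Function.update_of_ne hne]
    · rw [assemble_update hwj, hsl, hsl']
  · cases h

/-- Steps to the right suffice, because reachability is symmetric. -/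
theorem Tile.slide_all : ∀ s ∈ [0, 1], (mid (.mob s)).upper (leaf s) = [] ∧
    (mid (.mob s)).has (leaf s + (0, -1)) = true ∧ (mid (.mob s)).has (leaf s + (1, -1)) = true ∧
    (mid (.mob s)).has (leaf s + (1, 0)) = false ∧ (mid (.mob s)).has (leaf s + (0, 1)) = false ∧
    (mid (.mob s)).has (leaf s + (1, 1)) = false := by
  decide +kernel

/-- A sliding module can make one step to the right. -/
theorem pivotMove_slide (M : MoveSet) {w : Fin k → Mid} {j : Fin k} {s s' : Fin 3}
    (hw : w j = .mob s) (hs : s'.val = s.val + 1) :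
    PivotMove M (assemble w) (assemble (Function.update w j (.mob s'))) := by
  have ha : slider j s ∈ assemble w := by
    have := assemble_update hw s
    rw [← hw, Function.update_eq_self] at this
    rw [this]
    exact Finset.mem_insert_self _ _
  obtain ⟨τ, q, hL⟩ := exists_looksLike ha
  have hlt := s.isLt
  have hlt' := s'.isLt
  have hdiv : (slider j s).1 / 11 = j + 1 := by simp only [slider]; omega
  obtain rfl : τ = .mid (.mob s) := by
    have := hL.tileAt_eq
    rw [hdiv, tileAt_mid, hw] at this
    exact (Option.some.inj this).symm
  obtain rfl : q = leaf s := by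
    rw [hL.eq]
    refine Prod.ext ?_ rfl
    simp only [slider, leaf]
    omega
  obtain ⟨h0, h1, h2, h3, h4, h5⟩ := Tile.slide_all s (by
    have : s = 0 ∨ s = 1 := by omega
    simpa using this)
  rw [← hL.mem_iff _ (by norm_num)] at h1 h2
  rw [← Bool.not_eq_true, ← hL.mem_iff _ (by norm_num)] at h3 h4 h5
  have hr : RestrictivePivot (assemble w) (slider j s) (slider j s') := by
    refine ⟨(1, 0), (0, 1), frame_iff.2 (by decide), ?_, Or.inl ⟨?_, ⟨h3, h4, ?_⟩, ?_⟩⟩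
    · simpa [sub_eq_add_neg] using h1
    · rw [add_sub_assoc]
      simpa using h2
    · rw [add_assoc]
      simpa using h5
    · refine Prod.ext ?_ ?_
      · simp only [slider, Prod.fst_add]
        omega
      · simp [slider]
  refine ⟨slider j s, ha, slider j s', ?_, ?_, assemble_update hw s'⟩
  · cases M
    · exact hr
    · exact Or.inl hr
  · refine facetConnected_assemble_erase ha ?_ hL h0
    simp [slider]

/-! ### Translates of assembled configurations -/

theorem Tile.cells_injective : ∀ τ ∈ Tile.all, ∀ τ' ∈ Tile.all, τ.cells = τ'.cells → τ = τ' := by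
  decide +kernel

theorem fst_nonneg_of_mem_assemble {w : Fin k → Mid} {p : Cell} (h : p ∈ assemble w) : 0 ≤ p.1 := by
  obtain ⟨τ, h, -⟩ := mem_assemble.1 h
  have := (tileAt_bounds h).1
  omega

theorem mem_assemble_zero {w : Fin k → Mid} {y : ℤ} :
    ((0, y) : Cell) ∈ assemble w ↔ -1 ≤ y ∧ y ≤ 5 := by
  rw [head_mem_iff w le_rfl (by norm_num)]
  simp only [Tile.has, Tile.rects, List.any_cons, List.any_nil, Bool.or_eq_true,
    Bool.and_eq_true, decide_eq_true_eq, Bool.false_eq_true, or_false]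
  omega

/-- The leftmost column is column 0 and occupies rows -1 to 5 for every word, which forces `t = 0`.
The tiles are then read off from their cells. -/
theorem eq_of_isTranslate {w w' : Fin k → Mid} {t : Cell}
    (h : IsTranslate t (assemble w) (assemble w')) : w = w' := by
  have key : ∀ {w w' : Fin k → Mid} {t : Cell}, IsTranslate t (assemble w) (assemble w') →
      0 ≤ t.1 := fun h => by
    simpa using fst_nonneg_of_mem_assemble ((h (0, 0)).1 (mem_assemble_zero.2 (by norm_num)))
  have h1 : t.1 = 0 := le_antisymm (by simpa using key h.symm) (key h)
  have h2 := (h (0, -1)).1 (mem_assemble_zero.2 (by norm_num))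
  have h3 := (h (0, 5)).1 (mem_assemble_zero.2 (by norm_num))
  obtain ⟨x, y⟩ := t
  obtain rfl : x = 0 := h1
  rw [Prod.mk_add_mk, add_zero, mem_assemble_zero] at h2 h3
  obtain rfl : y = 0 := by omega
  have heq : ∀ p, p ∈ assemble w ↔ p ∈ assemble w' := fun p => by
    rw [h p, show ((0, 0) : Cell) = 0 from rfl, add_zero]
  funext j
  have hcells : (Tile.mid (w j)).cells = (Tile.mid (w' j)).cells := by
    refine List.filter_congr fun q hq => ?_
    rw [Tile.mem_area] at hq
    rw [Bool.eq_iff_iff, ← Prod.mk.eta (p := q),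
      ← mem_assemble_iff (tileAt_mid w j) hq.1 hq.2.1, heq,
      mem_assemble_iff (tileAt_mid w' j) hq.1 hq.2.1]
  have := Tile.cells_injective _ (Tile.mem_all _) _ (Tile.mem_all _) hcells
  injection this

/-! ### The number of modules -/

/-- The number of modules of a tile. -/
def Mid.size : Mid → ℕ
  | .pad => 29
  | .bit _ => 28
  | .mob _ => 27

theorem Tile.card_cells (τ : Tile) : τ.cells.toFinset.card = τ.cells.length :=
  List.toFinset_card_of_nodup (Tile.nodup_area.filter _)

theorem card_assemble_fiber {w : Fin k → Mid} {i : ℤ} {τ : Tile} (h : tileAt w i = some τ) :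
    ((assemble w).filter fun p => p.1 / 11 = i).card = τ.cells.length := by
  rw [← Tile.card_cells]
  refine Finset.card_nbij' (fun p => (p.1 % 11, p.2)) (fun q => (11 * i + q.1, q.2)) ?_ ?_ ?_ ?_
  · rintro p hp
    simp only [Finset.coe_filter, Set.mem_ofPred_eq] at hp
    obtain ⟨hp, rfl⟩ := hp
    obtain ⟨τ', h1, h2⟩ := mem_assemble.1 hp
    obtain rfl : τ = τ' := Option.some.inj (h.symm.trans h1)
    simp only [List.coe_toFinset, Set.mem_ofPred_eq, Tile.mem_cells]
    exact ⟨by omega, by omega, h2⟩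
  · rintro q hq
    simp only [List.coe_toFinset, Set.mem_ofPred_eq, Tile.mem_cells] at hq
    simp only [Finset.coe_filter, Set.mem_ofPred_eq]
    exact ⟨(mem_assemble_iff h hq.1 hq.2.1).2 hq.2.2, by omega⟩
  · rintro p hp
    simp only [Finset.coe_filter, Set.mem_ofPred_eq] at hp
    exact Prod.ext (by simp only; omega) rfl
  · rintro q hq
    simp only [List.coe_toFinset, Set.mem_ofPred_eq, Tile.mem_cells] at hq
    exact Prod.ext (by simp only; omega) rfl

/-- The constant is `32 + 10`, from the first and the last tile. -/
theorem card_assemble (w : Fin k → Mid) : (assemble w).card = 42 + ∑ i, (w i).size := by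
  have hmaps : ∀ p ∈ assemble w, p.1 / 11 ∈ Finset.Icc (0 : ℤ) (k + 1) := by
    intro p hp
    obtain ⟨τ, h, -⟩ := mem_assemble.1 hp
    exact Finset.mem_Icc.2 (tileAt_bounds h)
  rw [Finset.card_eq_sum_card_fiberwise hmaps]
  have hsplit : Finset.Icc (0 : ℤ) (k + 1) =
      insert 0 (insert ((k : ℤ) + 1) (Finset.univ.image fun i : Fin k => (i : ℤ) + 1)) := by
    ext i
    simp only [Finset.mem_Icc, Finset.mem_insert, Finset.mem_image, Finset.mem_univ, true_and]
    constructor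
    · intro h
      by_cases h0 : i = 0
      · exact Or.inl h0
      by_cases h1 : i = k + 1
      · exact Or.inr (Or.inl h1)
      · exact Or.inr (Or.inr ⟨⟨(i - 1).toNat, by omega⟩, by simp only; omega⟩)
    · rintro (rfl | rfl | ⟨j, rfl⟩) <;> omega
  obtain ⟨hh, ht, hp, hb, hm⟩ := Tile.length_cells
  rw [hsplit, Finset.sum_insert, Finset.sum_insert,
    Finset.sum_image fun (i : Fin k) _ (j : Fin k) _ (h : (i : ℤ) + 1 = j + 1) => Fin.ext (by omega),
    card_assemble_fiber (tileAt_zero w), card_assemble_fiber (tileAt_last w), hh, ht, ← add_assoc]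
  · congr 1
    refine Finset.sum_congr rfl fun i _ => ?_
    rw [card_assemble_fiber (tileAt_mid w i)]
    cases w i
    exacts [hp, hb _, hm _]
  · simp only [Finset.mem_image, Finset.mem_univ, true_and, not_exists]
    exact fun i => by omega
  · simp only [Finset.mem_insert, Finset.mem_image, Finset.mem_univ, true_and, not_or, not_exists]
    exact ⟨by omega, fun i => by omega⟩

variable {n : ℕ}

/-! ### The components of assembled configurations -/

/-- The configuration assembled from `w`, up to translation. -/
noncomputable def wordConfig (w : Fin k → Mid) (h : (assemble w).card = n) : Config n :=
  PlacedConfig.toConfig ⟨assemble w, h, facetConnected_assemble w⟩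

theorem wordConfig_injective {w w' : Fin k → Mid} {h : (assemble w).card = n}
    {h' : (assemble w').card = n} (heq : wordConfig w h = wordConfig w' h') : w = w' := by
  obtain ⟨t, ht⟩ := PlacedConfig.toConfig_eq_iff.1 heq
  exact eq_of_isTranslate ht

theorem onlyPatternI_wordConfig (w : Fin k → Mid) (h : (assemble w).card = n) :
    OnlyPatternI (wordConfig w h) := by
  intro C hC
  obtain ⟨t, ht⟩ := PlacedConfig.toConfig_eq_iff.1 hC
  exact ⟨ht.symm.hasPatternI (hasPatternI_assemble w),
    fun hG => not_hasPatternGamma_assemble w (ht.hasPatternGamma hG),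
    fun hZ => not_hasPatternZ_assemble w (ht.hasPatternZ hZ)⟩

/-- The tiles agree up to the states of the sliding modules. -/
def SameSkeleton (w w' : Fin k → Mid) : Prop := ∀ i, (w' i).skeleton = (w i).skeleton

theorem Mid.size_skeleton (m : Mid) : m.skeleton.size = m.size := by
  cases m <;> rfl

theorem SameSkeleton.card_eq {w w' : Fin k → Mid} (h : SameSkeleton w w') :
    (assemble w').card = (assemble w).card := by
  rw [card_assemble, card_assemble]
  congr 1
  refine Finset.sum_congr rfl fun i _ => ?_
  rw [← Mid.size_skeleton, h i, Mid.size_skeleton]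

theorem exists_of_pivotMove {M : MoveSet} {w : Fin k → Mid} (h : (assemble w).card = n)
    {C D : PlacedConfig n} (hC : C.toConfig = wordConfig w h) (hCD : PivotMove M C.1 D.1) :
    ∃ w' h', SameSkeleton w w' ∧ D.toConfig = wordConfig w' h' := by
  obtain ⟨t, ht⟩ := PlacedConfig.toConfig_eq_iff.1 hC
  obtain ⟨D', hm, hD'⟩ := ht.pivotMove hCD
  obtain ⟨w', hw', rfl⟩ := hm.exists_eq_assemble
  have hs : SameSkeleton w w' := hw'
  exact ⟨w', hs.card_eq.trans h, hs, PlacedConfig.toConfig_eq_iff.2 ⟨t, hD'⟩⟩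

theorem exists_of_adj {M : MoveSet} {w : Fin k → Mid} (h : (assemble w).card = n) {Y : Config n}
    (hY : (reconfigurationGraph M n).Adj (wordConfig w h) Y) :
    ∃ w' h', SameSkeleton w w' ∧ Y = wordConfig w' h' := by
  rw [reconfigurationGraph, SimpleGraph.fromRel_adj] at hY
  obtain ⟨-, ⟨C, D, hC, rfl, hm⟩ | ⟨C, D, rfl, hD, hm⟩⟩ := hY
  · exact exists_of_pivotMove h hC hm
  · exact exists_of_pivotMove h hD hm.symm

theorem exists_of_reachable {M : MoveSet} {w : Fin k → Mid} (h : (assemble w).card = n)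
    {Y : Config n} (hY : (reconfigurationGraph M n).Reachable (wordConfig w h) Y) :
    ∃ w' h', SameSkeleton w w' ∧ Y = wordConfig w' h' := by
  obtain ⟨W⟩ := hY
  have key : ∀ (X Y : Config n), (reconfigurationGraph M n).Walk X Y →
      (∃ w' h', SameSkeleton w w' ∧ X = wordConfig w' h') →
      ∃ w' h', SameSkeleton w w' ∧ Y = wordConfig w' h' := by
    intro X Y W
    induction W with
    | nil => exact id
    | cons hadj _ ih =>
      rintro ⟨w', h', hs, rfl⟩
      obtain ⟨w'', h'', hs', rfl⟩ := exists_of_adj h' hadj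
      exact ih ⟨w'', h'', fun i => (hs' i).trans (hs i), rfl⟩
  exact key _ _ W ⟨w, h, fun _ => rfl, rfl⟩

/-- The configurations of `n` modules assembled from `w` and `w'` are in the same component. -/
def Joined (M : MoveSet) (n : ℕ) (w w' : Fin k → Mid) : Prop :=
  ∃ (h : (assemble w).card = n) (h' : (assemble w').card = n),
    (reconfigurationGraph M n).Reachable (wordConfig w h) (wordConfig w' h')

namespace Joined

variable {M : MoveSet} {w w' w'' : Fin k → Mid}

theorem refl (h : (assemble w).card = n) : Joined M n w w := ⟨h, h, SimpleGraph.Reachable.refl _⟩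

theorem symm (h : Joined M n w w') : Joined M n w' w := by
  obtain ⟨h1, h2, h⟩ := h
  exact ⟨h2, h1, h.symm⟩

theorem trans (h : Joined M n w w') (h' : Joined M n w' w'') : Joined M n w w'' := by
  obtain ⟨h1, h2, h⟩ := h
  obtain ⟨h3, h4, h'⟩ := h'
  exact ⟨h1, h4, h.trans h'⟩

theorem of_pivotMove (h : (assemble w).card = n) (h' : (assemble w').card = n)
    (hm : PivotMove M (assemble w) (assemble w')) : Joined M n w w' := by
  refine ⟨h, h', ?_⟩
  by_cases heq : wordConfig w h = wordConfig w' h'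
  · rw [heq]
  · refine SimpleGraph.Adj.reachable ?_
    rw [reconfigurationGraph, SimpleGraph.fromRel_adj]
    exact ⟨heq, Or.inl ⟨_, _, rfl, rfl, hm⟩⟩

end Joined

theorem sameSkeleton_update {w : Fin k → Mid} {j : Fin k} {s : Fin 3} (hw : w j = .mob s)
    (s' : Fin 3) : SameSkeleton w (Function.update w j (.mob s')) := by
  intro i
  rcases eq_or_ne i j with rfl | hne
  · rw [Function.update_self, hw]
    rfl
  · rw [Function.update_of_ne hne]

theorem joined_update (M : MoveSet) {w : Fin k → Mid} (h : (assemble w).card = n) {j : Fin k}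
    {s : Fin 3} (hw : w j = .mob s) (s' : Fin 3) :
    Joined M n w (Function.update w j (.mob s')) := by
  have hcard : ∀ t, (assemble (Function.update w j (.mob t))).card = n := fun t =>
    (sameSkeleton_update hw t).card_eq.trans h
  have step : ∀ t t' : Fin 3, t'.val = t.val + 1 →
      Joined M n (Function.update w j (.mob t)) (Function.update w j (.mob t')) := by
    intro t t' ht
    refine Joined.of_pivotMove (hcard t) (hcard t') ?_
    have := pivotMove_slide M (w := Function.update w j (.mob t)) (Function.update_self ..) ht
    rwa [Function.update_idem] at this
  have h01 := step 0 1 rfl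
  have h12 := step 1 2 rfl
  have all : ∀ t, Joined M n (Function.update w j (.mob 0)) (Function.update w j (.mob t)) := by
    intro t
    fin_cases t
    exacts [Joined.refl (hcard 0), h01, h01.trans h12]
  have := (all s).symm.trans (all s')
  rwa [← hw, Function.update_eq_self] at this

theorem SameSkeleton.joined (M : MoveSet) {w w' : Fin k → Mid} (hs : SameSkeleton w w')
    (h : (assemble w).card = n) : Joined M n w w' := by
  -- The tiles of `w` are replaced by those of `w'` one at a time; a tile that changes holds a
  -- slider.
  have key : ∀ S : Finset (Fin k), Joined M n w (S.piecewise w' w) := by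
    intro S
    induction S using Finset.induction_on with
    | empty => rw [Finset.piecewise_empty]; exact Joined.refl h
    | insert j S hj ih =>
      rw [Finset.piecewise_insert]
      have hv : S.piecewise w' w j = w j := Finset.piecewise_eq_of_notMem _ _ _ hj
      have hsj := hs j
      by_cases heq : w' j = w j
      · rwa [heq, ← hv, Function.update_eq_self]
      · obtain ⟨s, hs⟩ : ∃ s, w j = .mob s := by
          generalize w j = x, w' j = y at *
          cases x <;> cases y <;> simp_all [Mid.skeleton]
        obtain ⟨s', hs'⟩ : ∃ s, w' j = .mob s := by
          generalize w j = x, w' j = y at *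
          cases x <;> cases y <;> simp_all [Mid.skeleton]
        rw [hs']
        obtain ⟨-, h2, -⟩ := id ih
        exact ih.trans (joined_update M h2 (hv.trans hs) s')
  simpa using key Finset.univ

theorem mem_supp_iff (M : MoveSet) {w : Fin k → Mid} (h : (assemble w).card = n) {X : Config n} :
    X ∈ ((reconfigurationGraph M n).connectedComponentMk (wordConfig w h)).supp ↔
      ∃ w' h', SameSkeleton w w' ∧ X = wordConfig w' h' := by
  rw [SimpleGraph.ConnectedComponent.mem_supp_iff, SimpleGraph.ConnectedComponent.eq]
  constructor
  · intro hX
    exact exists_of_reachable h hX.symm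
  · rintro ⟨w', h', hs, rfl⟩
    obtain ⟨_, _, hr⟩ := hs.joined M h
    exact hr.symm

theorem mk_mem_patternIComponents (M : MoveSet) {w : Fin k → Mid} (h : (assemble w).card = n) :
    (reconfigurationGraph M n).connectedComponentMk (wordConfig w h) ∈ patternIComponents M n := by
  intro X hX
  obtain ⟨w', h', -, rfl⟩ := (mem_supp_iff M h).1 hX
  exact onlyPatternI_wordConfig w' h'

/-! ### Counting -/

/-- The word with `j` static tiles, `m` tiles with a sliding module and `a` tiles with a bump. -/
def word (j : ℕ) {m a : ℕ} (s : Fin m → Fin 3) (b : Fin a → Bool) : Fin (j + m + a) → Mid :=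
  Fin.append (Fin.append (fun _ : Fin j => Mid.pad) fun i => Mid.mob (s i)) fun i => Mid.bit (b i)

variable {j m a : ℕ}

theorem card_assemble_word (s : Fin m → Fin 3) (b : Fin a → Bool) :
    (assemble (word j s b)).card = 42 + 29 * j + 27 * m + 28 * a := by
  simp only [card_assemble, word, Fin.sum_univ_add, Fin.append_left, Fin.append_right, Mid.size,
    Finset.sum_const, Finset.card_univ, Fintype.card_fin, smul_eq_mul]
  ring

theorem sameSkeleton_word (s s' : Fin m → Fin 3) (b : Fin a → Bool) :
    SameSkeleton (word j s b) (word j s' b) := by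
  intro i
  refine Fin.addCases (fun i => ?_) (fun i => ?_) i
  · refine Fin.addCases (fun i => ?_) (fun i => ?_) i <;>
      simp [word, Fin.append_left, Fin.append_right, Mid.skeleton]
  · simp [word, Fin.append_right]

theorem bits_eq_of_sameSkeleton {s s' : Fin m → Fin 3} {b b' : Fin a → Bool}
    (h : SameSkeleton (word j s b) (word j s' b')) : b = b' := by
  funext i
  have := h (Fin.natAdd _ i)
  simp only [word, Fin.append_right, Mid.skeleton, Mid.bit.injEq] at this
  exact this.symm

theorem word_injective (b : Fin a → Bool) :
    Function.Injective fun s : Fin m → Fin 3 => word j s b := by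
  intro s s' h
  funext i
  have := congrFun h (Fin.castAdd _ (Fin.natAdd _ i))
  simpa only [word, Fin.append_left, Fin.append_right, Mid.mob.injEq] using this

theorem eq_of_sameSkeleton_of_forall {w w' : Fin k → Mid} (h : SameSkeleton w w')
    (hw : ∀ i s, w i ≠ .mob s) : w' = w := by
  funext i
  have h1 := h i
  have h2 := hw i
  generalize w i = x, w' i = y at *
  cases x <;> cases y <;> simp_all [Mid.skeleton]

theorem word_ne_mob (s : Fin 0 → Fin 3) (b : Fin a → Bool) (i : Fin (j + 0 + a)) (t : Fin 3) :
    word j s b i ≠ .mob t := by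
  refine Fin.addCases (fun i => ?_) (fun i => ?_) i
  · refine Fin.addCases (fun i => ?_) (fun i => i.elim0) i
    simp only [word, Fin.append_left, ne_eq, reduceCtorEq, not_false_eq_true]
  · simp [word, Fin.append_right]

instance instFiniteComponent (M : MoveSet) (n : ℕ) :
    Finite (reconfigurationGraph M n).ConnectedComponent :=
  Finite.of_surjective (reconfigurationGraph M n).connectedComponentMk Quot.mk_surjective

/-- All nodes of a component share one skeleton, which records the bumps; different `b` therefore
give different components. The predicate `P` serves both claims. -/
theorem two_pow_le_ncard (M : MoveSet) (hn : 42 + 29 * j + 27 * m + 28 * a = n)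
    (P : (reconfigurationGraph M n).ConnectedComponent → Prop)
    (hP : ∀ b : Fin a → Bool, P ((reconfigurationGraph M n).connectedComponentMk
      (wordConfig (word j (fun _ : Fin m => 0) b) ((card_assemble_word _ b).trans hn)))) :
    2 ^ a ≤ {K ∈ patternIComponents M n | P K}.ncard := by
  let F : (Fin a → Bool) → (reconfigurationGraph M n).ConnectedComponent := fun b =>
    (reconfigurationGraph M n).connectedComponentMk
      (wordConfig (word j (fun _ : Fin m => 0) b) ((card_assemble_word _ b).trans hn))
  have hF : Function.Injective F := by
    intro b b' h
    obtain ⟨w, hw, hs, heq⟩ := exists_of_reachable ((card_assemble_word _ b).trans hn)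
      (SimpleGraph.ConnectedComponent.exact h)
    rw [← wordConfig_injective heq] at hs
    exact bits_eq_of_sameSkeleton hs
  have hsub : Set.range F ⊆ {K ∈ patternIComponents M n | P K} := by
    rintro _ ⟨b, rfl⟩
    exact ⟨mk_mem_patternIComponents M _, hP b⟩
  have := Set.ncard_le_ncard hsub (Set.toFinite _)
  rwa [← Set.image_univ, Set.ncard_image_of_injective _ hF, Set.ncard_univ, Nat.card_eq_fintype_card,
    Fintype.card_fun, Fintype.card_bool, Fintype.card_fin] at this

theorem ncard_supp_eq_one (M : MoveSet) {w : Fin k → Mid} (h : (assemble w).card = n)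
    (hw : ∀ i s, w i ≠ .mob s) :
    ((reconfigurationGraph M n).connectedComponentMk (wordConfig w h)).supp.ncard = 1 := by
  rw [Set.ncard_eq_one]
  refine ⟨wordConfig w h, Set.ext fun X => ?_⟩
  rw [mem_supp_iff, Set.mem_singleton_iff]
  constructor
  · rintro ⟨w', h', hs, rfl⟩
    obtain rfl := eq_of_sameSkeleton_of_forall hs hw
    rfl
  · rintro rfl
    exact ⟨w, h, fun _ => rfl, rfl⟩

theorem three_pow_le_ncard_supp (M : MoveSet) (s : Fin m → Fin 3) (b : Fin a → Bool)
    (h : (assemble (word j s b)).card = n) :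
    3 ^ m ≤ ((reconfigurationGraph M n).connectedComponentMk
      (wordConfig (word j s b) h)).supp.ncard := by
  let F : (Fin m → Fin 3) → Config n := fun s' =>
    wordConfig (word j s' b) ((sameSkeleton_word s s' b).card_eq.trans h)
  have hF : Function.Injective F := fun s' s'' h => word_injective b (wordConfig_injective h)
  have hsub : Set.range F ⊆ ((reconfigurationGraph M n).connectedComponentMk
      (wordConfig (word j s b) h)).supp := by
    rintro _ ⟨s', rfl⟩
    exact (mem_supp_iff M h).2 ⟨_, _, sameSkeleton_word s s' b, rfl⟩
  have := Set.ncard_le_ncard hsub (Set.toFinite _)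
  rwa [← Set.image_univ, Set.ncard_image_of_injective _ hF, Set.ncard_univ, Nat.card_eq_fintype_card,
    Fintype.card_fun, Fintype.card_fin, Fintype.card_fin] at this

/-- Since `112 = 4 * 28`, it suffices that `a` is about a quarter of the number of tiles; `201 /
200` is chosen so that its 112th power is at most 2. -/
theorem pow_le_two_pow {n a : ℕ} (h : n ≤ 112 * a) : (201 / 200 : ℝ) ^ n ≤ 2 ^ a :=
  calc (201 / 200 : ℝ) ^ n ≤ (201 / 200 : ℝ) ^ (112 * a) :=
        pow_le_pow_right₀ (by norm_num) h
    _ = ((201 / 200 : ℝ) ^ 112) ^ a := pow_mul _ _ _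
    _ ≤ 2 ^ a := pow_le_pow_left₀ (by positivity) (by norm_num) _

end PivotingSquares

/-! ### Choice of the words for a given number of modules -/

open PivotingSquares in
theorem mainTheorem4 (M : PivotingSquares.MoveSet) :
    (∃ c : ℝ, 1 < c ∧ ∀ᶠ n : ℕ in Filter.atTop,
      c ^ n ≤ ({K ∈ PivotingSquares.patternIComponents M n | K.supp.ncard = 1}.ncard : ℝ)) ∧
    (∃ c d : ℝ, 1 < c ∧ 1 < d ∧ ∀ᶠ n : ℕ in Filter.atTop,
      c ^ n ≤ ({K ∈ PivotingSquares.patternIComponents M n |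
        d ^ n ≤ (K.supp.ncard : ℝ)}.ncard : ℝ)) := by
  refine ⟨⟨201 / 200, by norm_num, ?_⟩, ⟨201 / 200, 201 / 200, by norm_num, by norm_num, ?_⟩⟩
  · filter_upwards [Filter.eventually_ge_atTop 10000] with n hn
    -- Start from `q` tiles of 28 modules. Turning `j` of them into tiles of 29 realizes the residue
    -- of `n - 42` modulo 28.
    obtain ⟨q, j, hj, hq⟩ : ∃ q j, j < 28 ∧ n = 42 + 28 * q + j :=
      ⟨(n - 42) / 28, (n - 42) % 28, by omega, by omega⟩
    have hle := two_pow_le_ncard M (n := n) (j := j) (m := 0) (a := q - j) (by omega)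
      (fun K => K.supp.ncard = 1) fun b => ncard_supp_eq_one M _ (word_ne_mob _ b)
    refine (pow_le_two_pow (a := q - j) (by omega)).trans ?_
    exact_mod_cast hle
  · filter_upwards [Filter.eventually_ge_atTop 10000] with n hn
    obtain ⟨q, j, hj, hq⟩ : ∃ q j, j < 28 ∧ n = 42 + 28 * q + j :=
      ⟨(n - 42) / 28, (n - 42) % 28, by omega, by omega⟩
    -- Trading `27 * t` tiles of 28 modules for `28 * t` tiles of 27 preserves the total. With `t`
    -- about `q / 60`, both the sliders and the remaining bumps are numerous enough.
    obtain ⟨t, ht, ht'⟩ : ∃ t, 60 * t ≤ q ∧ q < 60 * t + 60 := ⟨q / 60, by omega, by omega⟩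
    have hle := two_pow_le_ncard M (n := n) (j := j) (m := 28 * t) (a := q - j - 27 * t) (by omega)
      (fun K => (201 / 200 : ℝ) ^ n ≤ (K.supp.ncard : ℝ)) fun b => by
        refine (pow_le_two_pow (a := 28 * t) (by omega)).trans ?_
        refine (pow_le_pow_left₀ (by norm_num) (by norm_num : (2 : ℝ) ≤ 3) _).trans ?_
        exact_mod_cast three_pow_le_ncard_supp M _ b _
    refine (pow_le_two_pow (a := q - j - 27 * t) (by omega)).trans ?_
    exact_mod_cast hle
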